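/- Let $n\ge 1$, let $\mathbb B^{n+1}$ be the unit ball model of hyperbolic $(n+1)$-space with hyperbolic distance $d$, and let $\mathbb S^n$ be its sphere at infinity. Let $G$ be a torsion-free Kleinian group, i.e. a torsion-free discrete group of orientation preserving isometries of $\mathbb B^{n+1}$, and let $M_G=\mathbb B^{n+1}/G$ be the quotient hyperbolic manifold. The limit set $L(G)\subset\mathbb S^n$ is the set of accumulation points on $\mathbb S^n$ of the $G$-orbits, and the big horospheric limit set $L_H(G)$ is the set of all $\xi\in L(G)$ such that for every $x\in\mathbb B^{n+1}$ some horoball bounded by a horosphere tangent to $\mathbb S^n$ at $\xi$ contains infinitely many points of the orbit $Gx$. Fix $z\in\mathbb B^{n+1}$ and $\xi\in\mathbb S^n$, let $\tilde g_{\xi,z}$ be the unit speed geodesic line in $\mathbb B^{n+1}$ with $\tilde g_{\xi,z}(0)=z$ and $\tilde g_{\xi,z}(t)\to\xi$ as $t\to\infty$, and let $g_{\xi,z}$ be its projection to $M_G$. Then $\xi\in L_H(G)$ if and only if there are a sequence $0=t_0<t_1<t_2<\cdots$ converging to infinity, a constant $M\in\mathbb R$, and, for each $k\ge 0$, a geodesic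 segment $\beta_k$ in $M_G$ (a locally distance-minimising curve, not necessarily globally minimising and possibly degenerate to a point) connecting $g_{\xi,z}(0)$ to $g_{\xi,z}(t_k)$, of length at most $t_k+M$, such that the closed curves obtained by running along $g_{\xi,z}([0,t_k])$ and then back along $\beta_k$, $k\ge 0$, are mutually not freely homotopic in $M_G$. -/

import Mathlib

open Filter Topology

/-- The open unit ball `𝔹^{n+1}` of `ℝ^{n+1}`, with the subspace topology: the underlying space of
the ball model of hyperbolic `(n+1)`-space. -/
abbrev HypBall (n : ℕ) : Type :=
  {x : EuclideanSpace ℝ (Fin (n + 1)) // ‖x‖ < 1}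

/-- The sphere at infinity `𝕊^n`. -/
abbrev SphereAtInfinity (n : ℕ) : Type :=
  Metric.sphere (0 : EuclideanSpace ℝ (Fin (n + 1))) 1

/-- The hyperbolic distance (curvature `-1`) of the ball model. -/
noncomputable def hypDist {n : ℕ} (x y : HypBall n) : ℝ :=
  Real.arcosh (1 + 2 * ‖(x : EuclideanSpace ℝ (Fin (n + 1))) - y‖ ^ 2 /
    ((1 - ‖(x : EuclideanSpace ℝ (Fin (n + 1)))‖ ^ 2) *
      (1 - ‖(y : EuclideanSpace ℝ (Fin (n + 1)))‖ ^ 2)))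

/-- A bijection of the ball is a hyperbolic isometry. -/
def IsHypIsometry {n : ℕ} (φ : Equiv.Perm (HypBall n)) : Prop :=
  ∀ x y, hypDist (φ x) (φ y) = hypDist x y

/-- A bijection of the ball is orientation preserving: it is differentiable with positive Jacobian
determinant everywhere (hyperbolic isometries are smooth). The values of the extension outside the
open ball do not matter. -/
def IsOrientationPreserving {n : ℕ} (φ : Equiv.Perm (HypBall n)) : Prop :=
  ∀ x : HypBall n, ∃ φ' : EuclideanSpace ℝ (Fin (n + 1)) →L[ℝ] EuclideanSpace ℝ (Fin (n + 1)),
    HasFDerivAt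
      (fun y : EuclideanSpace ℝ (Fin (n + 1)) =>
        if h : ‖y‖ < 1 then (φ ⟨y, h⟩ : EuclideanSpace ℝ (Fin (n + 1))) else 0)
      φ' (x : EuclideanSpace ℝ (Fin (n + 1))) ∧
    0 < φ'.det

/-- A Kleinian group: a discrete group of orientation preserving isometries of hyperbolic space.
The isometry group carries the topology of pointwise convergence (which, for isometries, is the
compact-open topology). -/
structure IsKleinian {n : ℕ} (G : Subgroup (Equiv.Perm (HypBall n))) : Prop where
  isometry : ∀ φ ∈ G, IsHypIsometry φ
  orientation : ∀ φ ∈ G, IsOrientationPreserving φ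
  discrete : DiscreteTopology
    ((fun φ : Equiv.Perm (HypBall n) => (φ : HypBall n → HypBall n)) ''
      (G : Set (Equiv.Perm (HypBall n))))

/-- `G` is torsion free. -/
def IsTorsionFreeSubgroup {n : ℕ} (G : Subgroup (Equiv.Perm (HypBall n))) : Prop :=
  ∀ φ ∈ G, IsOfFinOrder φ → φ = 1

/-- The limit set `L(G)`: the points of the sphere at infinity at which the `G`-orbits accumulate. -/
def limitSet {n : ℕ} (G : Subgroup (Equiv.Perm (HypBall n))) : Set (SphereAtInfinity n) :=
  {ξ | ∀ x : HypBall n, AccPt (ξ : EuclideanSpace ℝ (Fin (n + 1)))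
    (𝓟 ((fun y : HypBall n => (y : EuclideanSpace ℝ (Fin (n + 1)))) '' MulAction.orbit G x))}

/-- The open horoball at `ξ` of Euclidean radius `r`, `0 < r < 1`; it is bounded by the horosphere
of Euclidean radius `r`, which is tangent to `𝕊^n` at `ξ`. -/
def horoball {n : ℕ} (ξ : SphereAtInfinity n) (r : ℝ) : Set (HypBall n) :=
  {x | ‖(x : EuclideanSpace ℝ (Fin (n + 1))) -
    (1 - r) • (ξ : EuclideanSpace ℝ (Fin (n + 1)))‖ < r}

/-- The big horospheric limit set `L_H(G)`: limit points at which, for every orbit, some horoball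
contains infinitely many points of the orbit. -/
def bigHorosphericLimitSet {n : ℕ} (G : Subgroup (Equiv.Perm (HypBall n))) :
    Set (SphereAtInfinity n) :=
  {ξ | ξ ∈ limitSet G ∧ ∀ x : HypBall n, ∃ r : ℝ, 0 < r ∧ r < 1 ∧
    (MulAction.orbit G x ∩ horoball ξ r).Infinite}

/-- The quotient `M_G = 𝔹^{n+1} / G`, with the quotient topology. -/
abbrev QuotientManifold {n : ℕ} (G : Subgroup (Equiv.Perm (HypBall n))) : Type :=
  MulAction.orbitRel.Quotient G (HypBall n)

/-- The projection `𝔹^{n+1} → M_G`. -/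
def quotientProj {n : ℕ} (G : Subgroup (Equiv.Perm (HypBall n))) (x : HypBall n) :
    QuotientManifold G :=
  Quotient.mk (MulAction.orbitRel G (HypBall n)) x

theorem continuous_quotientProj {n : ℕ} (G : Subgroup (Equiv.Perm (HypBall n))) :
    Continuous (quotientProj G) :=
  continuous_quotient_mk'

/-- The hyperbolic distance on `M_G`: the distance between the corresponding orbits. -/
noncomputable def quotientDist {n : ℕ} (G : Subgroup (Equiv.Perm (HypBall n)))
    (p q : QuotientManifold G) : ℝ :=
  sInf {d : ℝ | ∃ x y : HypBall n, quotientProj G x = p ∧ quotientProj G y = q ∧ d = hypDist x y}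

/-- The path `β` in `M_G` is a geodesic segment of length `l`, parametrised on `[0,1]` with constant
speed `l`: it multiplies distances locally by `l`. (Geodesics need not be globally minimising, and
`l = 0` gives the constant path.) -/
def IsGeodesicSegment {n : ℕ} {G : Subgroup (Equiv.Perm (HypBall n))} {p q : QuotientManifold G}
    (β : Path p q) (l : ℝ) : Prop :=
  0 ≤ l ∧ ∀ s : unitInterval, ∃ U ∈ 𝓝 s, ∀ u ∈ U, ∀ v ∈ U,
    quotientDist G (β u) (β v) = l * |(u : ℝ) - (v : ℝ)|

/-- `g` is the unit speed geodesic line in the ball with `g 0 = z` that tends to `ξ` at `+∞`. -/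
structure IsGeodesicToward {n : ℕ} (ξ : SphereAtInfinity n) (z : HypBall n)
    (g : C(ℝ, HypBall n)) : Prop where
  unit_speed : ∀ s t : ℝ, hypDist (g s) (g t) = |s - t|
  start : g 0 = z
  endpoint : Tendsto (fun t : ℝ => (g t : EuclideanSpace ℝ (Fin (n + 1)))) atTop
    (𝓝 (ξ : EuclideanSpace ℝ (Fin (n + 1))))

/-- The projection to `M_G` of the arc `g([0,T])`, as a path. -/
def projectedArc {n : ℕ} (G : Subgroup (Equiv.Perm (HypBall n))) (g : C(ℝ, HypBall n)) (T : ℝ) :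
    Path (quotientProj G (g 0)) (quotientProj G (g T)) where
  toFun s := quotientProj G (g (T * (s : ℝ)))
  continuous_toFun := (continuous_quotientProj G).comp
    (g.continuous.comp (continuous_const.mul continuous_subtype_val))
  source' := by simp
  target' := by simp

/-- Two closed curves in `X`, with possibly different base points, are freely homotopic. -/
def FreelyHomotopic {X : Type*} [TopologicalSpace X] {p q : X} (c : Path p p) (c' : Path q q) :
    Prop :=
  ∃ H : C(unitInterval × unitInterval, X),
    (∀ s, H (0, s) = c s) ∧ (∀ s, H (1, s) = c' s) ∧ ∀ u, H (u, 0) = H (u, 1)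

/-! ### The ball model: hyperboloid coordinates, triangle inequality, properness, geodesics. -/

section HyperbolicMetric

variable {n : ℕ}

/-! The free homotopy statement becomes a statement about elements of `G`. Each loop at the image of
`z` lifts to a path from `z` to some `γ • z`, its holonomy. Loops with equal holonomy are freely
homotopic (`HasHolonomy.freelyHomotopic`), and freely homotopic loops have conjugate holonomies
(`HasHolonomy.isConj`). If `γ` is the holonomy of the loop built from `β_k`, then `β_k` lifts to a
path from `z` to `γ⁻¹ • g (t_k)`, so the length bound gives `d(γ z, g(t_k)) ≤ t_k + M = d(z, g(t_k))
+ M`. This confines `γ z` to a fixed horoball at `ξ`; conversely, points of a fixed horoball satisfy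
such a bound for all large times, with a common `M`.

Hence pairwise non-homotopic loops give infinitely many orbit points in one horoball. For the
converse, infinitely many orbit points in a horoball must yield pairwise nonconjugate elements with
orbit points in a common horoball (`IsKleinian.exists_seq_not_isConj`). Let `S` be the infinite set
of `γ` with `γ z` in the horoball; by discreteness these points accumulate only at `ξ`.

If for some `δ` infinitely many `γ ∈ S` keep `δ γ⁻¹ z` away from `ξ`, then `γ δ⁻¹` and its inverse
send `z` to points a definite Euclidean distance apart. Ptolemy's inequality then bounds the
displacement of `z` within a conjugacy class, so each class contains finitely many of these
elements.

Otherwise `δ γ⁻¹ z → ξ` along `S` for every `δ`, and every group element scales the Busemann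
exponential at `ξ` by a constant. If this character is nontrivial, it separates the powers of a
contracting element up to conjugacy. If it is trivial, inversion at `ξ` makes `G` act by Euclidean
isometries, and a positive translation length separates the powers of any nontrivial element. -/

theorem one_sub_norm_sq_pos (x : HypBall n) :
    0 < 1 - ‖(x : EuclideanSpace ℝ (Fin (n + 1)))‖ ^ 2 := by
  have h := x.2
  have h0 := norm_nonneg (x : EuclideanSpace ℝ (Fin (n + 1)))
  nlinarith

theorem cosh_hypDist (x y : HypBall n) :
    Real.cosh (hypDist x y) = 1 + 2 * ‖(x : EuclideanSpace ℝ (Fin (n + 1))) - y‖ ^ 2 /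
      ((1 - ‖(x : EuclideanSpace ℝ (Fin (n + 1)))‖ ^ 2) *
        (1 - ‖(y : EuclideanSpace ℝ (Fin (n + 1)))‖ ^ 2)) := by
  have hx := one_sub_norm_sq_pos x
  have hy := one_sub_norm_sq_pos y
  exact Real.cosh_arcosh (le_add_of_nonneg_right (by positivity))

theorem hypDist_nonneg (x y : HypBall n) : 0 ≤ hypDist x y := by
  have hx := one_sub_norm_sq_pos x
  have hy := one_sub_norm_sq_pos y
  exact Real.arcosh_nonneg (le_add_of_nonneg_right (by positivity))

theorem hypDist_le_iff_cosh_le {x y : HypBall n} {r : ℝ} (hr : 0 ≤ r) :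
    hypDist x y ≤ r ↔ Real.cosh (hypDist x y) ≤ Real.cosh r := by
  rw [Real.cosh_le_cosh, abs_of_nonneg (hypDist_nonneg x y), abs_of_nonneg hr]

theorem hypDist_eq_of_cosh_eq {x y : HypBall n} {r : ℝ} (hr : 0 ≤ r)
    (h : Real.cosh (hypDist x y) = Real.cosh r) : hypDist x y = r :=
  Real.cosh_injOn (hypDist_nonneg x y) hr h

@[simp] theorem hypDist_self (x : HypBall n) : hypDist x x = 0 := by
  simp [hypDist]

theorem hypDist_comm (x y : HypBall n) : hypDist x y = hypDist y x := by
  unfold hypDist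
  rw [norm_sub_rev, mul_comm (1 - ‖(x : EuclideanSpace ℝ (Fin (n + 1)))‖ ^ 2)]

/-- Apart from one conformal factor per point this is the Euclidean chord, so Euclidean identities
for four points or for inversions transfer to hyperbolic distance. -/
theorem sinh_half_hypDist (x y : HypBall n) :
    Real.sinh (hypDist x y / 2) = ‖(x : EuclideanSpace ℝ (Fin (n + 1))) - y‖ /
      (√(1 - ‖(x : EuclideanSpace ℝ (Fin (n + 1)))‖ ^ 2) *
        √(1 - ‖(y : EuclideanSpace ℝ (Fin (n + 1)))‖ ^ 2)) := by
  have hx := one_sub_norm_sq_pos x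
  have hy := one_sub_norm_sq_pos y
  have h1 : 0 ≤ Real.sinh (hypDist x y / 2) :=
    Real.sinh_nonneg_iff.2 (by have := hypDist_nonneg x y; positivity)
  rw [← sq_eq_sq₀ h1 (by positivity), div_pow, mul_pow, Real.sq_sqrt hx.le, Real.sq_sqrt hy.le]
  have h2 := cosh_hypDist x y
  have h3 : Real.cosh (hypDist x y) = 1 + 2 * Real.sinh (hypDist x y / 2) ^ 2 := by
    have := Real.cosh_two_mul (hypDist x y / 2)
    rw [mul_div_cancel₀ _ (two_ne_zero)] at this
    rw [this, Real.cosh_sq]; ring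
  rw [h3, mul_div_assoc] at h2
  linarith

theorem dist_le_sinh_half_hypDist (x y : HypBall n) :
    ‖(x : EuclideanSpace ℝ (Fin (n + 1))) - y‖ ≤ Real.sinh (hypDist x y / 2) := by
  have hx := one_sub_norm_sq_pos x
  have hy := one_sub_norm_sq_pos y
  rw [sinh_half_hypDist]
  refine le_div_self (norm_nonneg _) (by positivity) (mul_le_one₀ ?_ (by positivity) ?_)
  · exact Real.sqrt_le_one.2 (by nlinarith [sq_nonneg ‖(x : EuclideanSpace ℝ (Fin (n + 1)))‖])
  · exact Real.sqrt_le_one.2 (by nlinarith [sq_nonneg ‖(y : EuclideanSpace ℝ (Fin (n + 1)))‖])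

theorem eq_of_hypDist_eq_zero {x y : HypBall n} (h : hypDist x y = 0) : x = y := by
  have := dist_le_sinh_half_hypDist x y
  rw [h] at this
  simp only [zero_div, Real.sinh_zero] at this
  exact Subtype.ext (sub_eq_zero.1 (norm_le_zero_iff.1 this))

theorem continuous_hypDist : Continuous fun p : HypBall n × HypBall n => hypDist p.1 p.2 := by
  refine Real.continuousOn_arcosh.comp_continuous ?_ ?_
  · have hx : Continuous fun p : HypBall n × HypBall n =>
        (p.1 : EuclideanSpace ℝ (Fin (n + 1))) := continuous_subtype_val.comp continuous_fst
    have hy : Continuous fun p : HypBall n × HypBall n =>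
        (p.2 : EuclideanSpace ℝ (Fin (n + 1))) := continuous_subtype_val.comp continuous_snd
    have hnum : Continuous fun p : HypBall n × HypBall n =>
        2 * ‖(p.1 : EuclideanSpace ℝ (Fin (n + 1))) - p.2‖ ^ 2 := by fun_prop
    have hden : Continuous fun p : HypBall n × HypBall n =>
        (1 - ‖(p.1 : EuclideanSpace ℝ (Fin (n + 1)))‖ ^ 2) *
          (1 - ‖(p.2 : EuclideanSpace ℝ (Fin (n + 1)))‖ ^ 2) := by fun_prop
    refine continuous_const.add (hnum.div hden fun p => ?_)
    exact (mul_pos (one_sub_norm_sq_pos p.1) (one_sub_norm_sq_pos p.2)).ne'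
  · intro p
    have hx := one_sub_norm_sq_pos p.1
    have hy := one_sub_norm_sq_pos p.2
    have h : 0 ≤ 2 * ‖(p.1 : EuclideanSpace ℝ (Fin (n + 1))) - p.2‖ ^ 2 /
      ((1 - ‖(p.1 : EuclideanSpace ℝ (Fin (n + 1)))‖ ^ 2) *
        (1 - ‖(p.2 : EuclideanSpace ℝ (Fin (n + 1)))‖ ^ 2)) := by positivity
    exact Set.mem_Ici.2 (by linarith)

theorem Continuous.hypDist {X : Type*} [TopologicalSpace X] {f g : X → HypBall n}
    (hf : Continuous f) (hg : Continuous g) : Continuous fun a => hypDist (f a) (g a) := by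
  have h := continuous_hypDist.comp (hf.prodMk hg)
  exact h

/-- The time coordinate of the hyperboloid model. -/
noncomputable def hypTime (x : HypBall n) : ℝ :=
  (1 + ‖(x : EuclideanSpace ℝ (Fin (n + 1)))‖ ^ 2) /
    (1 - ‖(x : EuclideanSpace ℝ (Fin (n + 1)))‖ ^ 2)

/-- The space coordinates of the hyperboloid model. -/
noncomputable def hypSpace (x : HypBall n) : EuclideanSpace ℝ (Fin (n + 1)) :=
  (2 / (1 - ‖(x : EuclideanSpace ℝ (Fin (n + 1)))‖ ^ 2)) • (x : EuclideanSpace ℝ (Fin (n + 1)))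

theorem hypTime_pos (x : HypBall n) : 0 < hypTime x := by
  have hx := one_sub_norm_sq_pos x
  unfold hypTime
  positivity

theorem hypTime_sq (x : HypBall n) : hypTime x ^ 2 = 1 + ‖hypSpace x‖ ^ 2 := by
  have hx := one_sub_norm_sq_pos x
  unfold hypTime hypSpace
  rw [norm_smul, Real.norm_eq_abs, abs_of_nonneg (by positivity)]
  field_simp
  ring

/-- Passing to the Lorentz form reduces the triangle inequality and the construction of geodesics to
linear algebra. -/
theorem cosh_hypDist_eq_hyperboloid (x y : HypBall n) :
    Real.cosh (hypDist x y) = hypTime x * hypTime y - inner ℝ (hypSpace x) (hypSpace y) := by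
  have hx := one_sub_norm_sq_pos x
  have hy := one_sub_norm_sq_pos y
  rw [cosh_hypDist, norm_sub_sq_real]
  unfold hypTime hypSpace
  rw [real_inner_smul_left, real_inner_smul_right]
  field_simp
  ring

/-- The point of the ball with given hyperboloid coordinates. -/
noncomputable def ofHyperboloid (t : ℝ) (v : EuclideanSpace ℝ (Fin (n + 1))) (ht : 0 < t)
    (h : t ^ 2 = 1 + ‖v‖ ^ 2) : HypBall n :=
  ⟨(1 + t)⁻¹ • v, by
    rw [norm_smul, Real.norm_eq_abs, abs_of_pos (by positivity), inv_mul_lt_iff₀ (by positivity)]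
    nlinarith [norm_nonneg v]⟩

theorem norm_sq_ofHyperboloid (t : ℝ) (v : EuclideanSpace ℝ (Fin (n + 1))) (ht : 0 < t)
    (h : t ^ 2 = 1 + ‖v‖ ^ 2) :
    ‖(ofHyperboloid t v ht h : EuclideanSpace ℝ (Fin (n + 1)))‖ ^ 2 = (t - 1) / (1 + t) := by
  unfold ofHyperboloid
  simp only
  rw [norm_smul, Real.norm_eq_abs, abs_of_pos (by positivity), mul_pow]
  have : ‖v‖ ^ 2 = t ^ 2 - 1 := by linarith
  rw [this]
  field_simp
  ring

theorem hypTime_ofHyperboloid (t : ℝ) (v : EuclideanSpace ℝ (Fin (n + 1))) (ht : 0 < t)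
    (h : t ^ 2 = 1 + ‖v‖ ^ 2) : hypTime (ofHyperboloid t v ht h) = t := by
  unfold hypTime
  rw [norm_sq_ofHyperboloid]
  have : 1 - (t - 1) / (1 + t) = 2 / (1 + t) := by field_simp; ring
  rw [this]
  field_simp
  ring

theorem hypSpace_ofHyperboloid (t : ℝ) (v : EuclideanSpace ℝ (Fin (n + 1))) (ht : 0 < t)
    (h : t ^ 2 = 1 + ‖v‖ ^ 2) : hypSpace (ofHyperboloid t v ht h) = v := by
  unfold hypSpace
  rw [norm_sq_ofHyperboloid]
  have : 1 - (t - 1) / (1 + t) = 2 / (1 + t) := by field_simp; ring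
  rw [this]
  unfold ofHyperboloid
  simp only
  rw [smul_smul]
  have : 2 / (2 / (1 + t)) * (1 + t)⁻¹ = 1 := by field_simp
  rw [this, one_smul]

theorem ofHyperboloid_coords (x : HypBall n) :
    ofHyperboloid (hypTime x) (hypSpace x) (hypTime_pos x) (hypTime_sq x) = x := by
  have hx := one_sub_norm_sq_pos x
  apply Subtype.ext
  unfold ofHyperboloid hypTime hypSpace
  simp only
  rw [smul_smul]
  convert one_smul ℝ _ using 2
  field_simp
  ring

/-- Cauchy–Schwarz for the Lorentz form on the orthogonal complement of a timelike vector. -/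
theorem lorentz_cauchy_schwarz {V : Type*} [NormedAddCommGroup V] [InnerProductSpace ℝ V]
    {t a b : ℝ} {y u w : V} (ht : t ^ 2 = 1 + ‖y‖ ^ 2)
    (hu : inner ℝ u y = a * t) (hw : inner ℝ w y = b * t) :
    (inner ℝ u w - a * b) ^ 2 ≤ (‖u‖ ^ 2 - a ^ 2) * (‖w‖ ^ 2 - b ^ 2) := by
  -- A vector Lorentz-orthogonal to a timelike one is spacelike; Cauchy–Schwarz is then the
  -- discriminant bound for a nonnegative quadratic.
  have key : ∀ (c : ℝ) (v : V), inner ℝ v y = c * t → 0 ≤ ‖v‖ ^ 2 - c ^ 2 := by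
    intro c v hv
    have h1 : (c * t) ^ 2 ≤ ‖v‖ ^ 2 * ‖y‖ ^ 2 := by
      rw [← hv, ← mul_pow]
      exact sq_le_sq' (by linarith [neg_abs_le (inner ℝ v y), abs_real_inner_le_norm v y])
        (real_inner_le_norm v y)
    have h2 : c ^ 2 * (1 + ‖y‖ ^ 2) ≤ ‖v‖ ^ 2 * ‖y‖ ^ 2 := by rw [← ht]; linarith [mul_pow c t 2]
    by_contra hneg
    nlinarith [sq_nonneg ‖y‖, sq_nonneg ‖v‖]
  have hd : discrim (‖w‖ ^ 2 - b ^ 2) (2 * (inner ℝ u w - a * b)) (‖u‖ ^ 2 - a ^ 2) ≤ 0 := by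
    refine discrim_le_zero fun s => ?_
    have := key (a + s * b) (u + s • w) (by
      rw [inner_add_left, real_inner_smul_left, hu, hw]; ring)
    rw [norm_add_sq_real, norm_smul, real_inner_smul_right, mul_pow, Real.norm_eq_abs,
      sq_abs] at this
    linarith
  unfold discrim at hd
  linarith

/-- The vectors `x - c y` and `z - d y` are the Lorentz projections orthogonal to `y`, with norms
`sinh d(x,y)` and `sinh d(y,z)`. Cauchy–Schwarz for them bounds `cosh d(x,z)` by the addition
formula. -/
theorem hypDist_triangle (x y z : HypBall n) : hypDist x z ≤ hypDist x y + hypDist y z := by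
  have hd1 := hypDist_nonneg x y
  have hd2 := hypDist_nonneg y z
  rw [hypDist_le_iff_cosh_le (by positivity), Real.cosh_add]
  set c := Real.cosh (hypDist x y) with hc
  set d := Real.cosh (hypDist y z) with hd
  have hs1 : Real.sinh (hypDist x y) ^ 2 = c ^ 2 - 1 := by rw [hc, Real.cosh_sq]; ring
  have hs2 : Real.sinh (hypDist y z) ^ 2 = d ^ 2 - 1 := by rw [hd, Real.cosh_sq]; ring
  have hc' := cosh_hypDist_eq_hyperboloid x y
  have hd' := cosh_hypDist_eq_hyperboloid y z
  rw [← hc] at hc'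
  rw [← hd] at hd'
  have hx := hypTime_sq x
  have hy := hypTime_sq y
  have hz := hypTime_sq z
  have hyy : inner ℝ (hypSpace y) (hypSpace y) = hypTime y ^ 2 - 1 := by
    rw [real_inner_self_eq_norm_sq]; linarith
  have hxy : inner ℝ (hypSpace x) (hypSpace y) = hypTime x * hypTime y - c := by linarith
  have hyz : inner ℝ (hypSpace y) (hypSpace z) = hypTime y * hypTime z - d := by linarith
  have hzy : inner ℝ (hypSpace z) (hypSpace y) = hypTime y * hypTime z - d := by
    rw [real_inner_comm]; exact hyz
  have cs := lorentz_cauchy_schwarz (t := hypTime y) (a := hypTime x - c * hypTime y)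
    (b := hypTime z - d * hypTime y) (y := hypSpace y) (u := hypSpace x - c • hypSpace y)
    (w := hypSpace z - d • hypSpace y) hy
    (by rw [inner_sub_left, real_inner_smul_left, hxy, hyy]; ring)
    (by rw [inner_sub_left, real_inner_smul_left, hzy, hyy]; ring)
  have e1 : ‖hypSpace x - c • hypSpace y‖ ^ 2 - (hypTime x - c * hypTime y) ^ 2 = c ^ 2 - 1 := by
    rw [norm_sub_sq_real, real_inner_smul_right, norm_smul, mul_pow, hxy, Real.norm_eq_abs, sq_abs]
    have : ‖hypSpace x‖ ^ 2 = hypTime x ^ 2 - 1 := by linarith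
    have h' : ‖hypSpace y‖ ^ 2 = hypTime y ^ 2 - 1 := by linarith
    rw [this, h']; ring
  have e2 : ‖hypSpace z - d • hypSpace y‖ ^ 2 - (hypTime z - d * hypTime y) ^ 2 = d ^ 2 - 1 := by
    rw [norm_sub_sq_real, real_inner_smul_right, norm_smul, mul_pow, hzy, Real.norm_eq_abs, sq_abs]
    have : ‖hypSpace z‖ ^ 2 = hypTime z ^ 2 - 1 := by linarith
    have h' : ‖hypSpace y‖ ^ 2 = hypTime y ^ 2 - 1 := by linarith
    rw [this, h']; ring
  have e3 : inner ℝ (hypSpace x - c • hypSpace y) (hypSpace z - d • hypSpace y) -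
      (hypTime x - c * hypTime y) * (hypTime z - d * hypTime y) =
      c * d - Real.cosh (hypDist x z) := by
    rw [inner_sub_left, inner_sub_right, inner_sub_right, real_inner_smul_left,
      real_inner_smul_right, real_inner_smul_left, real_inner_smul_right, hxy, hyz, hyy,
      cosh_hypDist_eq_hyperboloid x z]
    ring
  rw [e1, e2, e3, ← hs1, ← hs2, ← mul_pow] at cs
  have hp : 0 ≤ Real.sinh (hypDist x y) * Real.sinh (hypDist y z) :=
    mul_nonneg (Real.sinh_nonneg_iff.2 hd1) (Real.sinh_nonneg_iff.2 hd2)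
  linarith [(abs_le_of_sq_le_sq' cs hp).1]

theorem isCompact_setOf_norm_sq_le {c : ℝ} (hc : c < 1) :
    IsCompact {y : HypBall n | ‖(y : EuclideanSpace ℝ (Fin (n + 1)))‖ ^ 2 ≤ c} := by
  rw [Topology.IsEmbedding.subtypeVal.isCompact_iff]
  have himage : (Subtype.val '' {y : HypBall n | ‖(y : EuclideanSpace ℝ (Fin (n + 1)))‖ ^ 2 ≤ c})
      = {y | ‖y‖ ^ 2 ≤ c} := by
    ext y
    constructor
    · rintro ⟨y, hy, rfl⟩
      exact hy
    · intro hy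
      have hlt : ‖y‖ ^ 2 < 1 := lt_of_le_of_lt hy hc
      exact ⟨⟨y, by nlinarith [norm_nonneg y]⟩, hy, rfl⟩
  rw [himage]
  refine Metric.isCompact_of_isClosed_isBounded
    (isClosed_le (continuous_norm.pow 2) continuous_const) ?_
  refine (Metric.isBounded_closedBall (x := 0) (r := 1)).subset fun y hy => ?_
  have hlt : ‖y‖ ^ 2 < 1 := lt_of_le_of_lt hy hc
  rw [mem_closedBall_zero_iff]
  nlinarith [norm_nonneg y]

theorem norm_sq_le_of_cosh_hypDist_zero_le {y : HypBall n} {C : ℝ} (hC : 0 < C)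
    (h : Real.cosh (hypDist ⟨0, by simp⟩ y) ≤ C) :
    ‖(y : EuclideanSpace ℝ (Fin (n + 1)))‖ ^ 2 ≤ C / (C + 1) := by
  have hy := one_sub_norm_sq_pos y
  rw [cosh_hypDist] at h
  simp only [zero_sub, norm_neg, norm_zero, ne_eq, OfNat.ofNat_ne_zero, not_false_eq_true,
    zero_pow, sub_zero, one_mul] at h
  rw [le_div_iff₀ (by positivity)]
  have h3 : 2 * ‖(y : EuclideanSpace ℝ (Fin (n + 1)))‖ ^ 2 ≤
      (C - 1) * (1 - ‖(y : EuclideanSpace ℝ (Fin (n + 1)))‖ ^ 2) := by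
    rw [← div_le_iff₀ hy]; linarith
  nlinarith

theorem isCompact_hypClosedBall (x : HypBall n) (R : ℝ) :
    IsCompact {y : HypBall n | hypDist x y ≤ R} := by
  obtain ⟨o, ho⟩ : ∃ o : HypBall n, o = ⟨0, by simp⟩ := ⟨_, rfl⟩
  have hC0 := Real.cosh_pos (hypDist o x + R)
  have hcl : IsClosed {y : HypBall n | hypDist x y ≤ R} :=
    isClosed_le (continuous_const.hypDist continuous_id) continuous_const
  have hK := isCompact_setOf_norm_sq_le (n := n)
    ((div_lt_one (by positivity)).2 (lt_add_one (Real.cosh (hypDist o x + R))))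
  refine hK.of_isClosed_subset hcl fun y hy => ?_
  have hy' : hypDist x y ≤ R := hy
  have h1 : hypDist o y ≤ hypDist o x + R := by linarith [hypDist_triangle o x y]
  have h2 := (hypDist_le_iff_cosh_le ((hypDist_nonneg o y).trans h1)).1 h1
  generalize Real.cosh (hypDist o x + R) = C at *
  subst ho
  exact norm_sq_le_of_cosh_hypDist_zero_le hC0 h2

/-- Any two points of the ball are joined by a geodesic segment of constant speed. -/
theorem exists_geodesic (x y : HypBall n) : ∃ σ : Path x y, ∀ u v : unitInterval,
    hypDist (σ u) (σ v) = hypDist x y * |(u : ℝ) - v| := by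
  by_cases hxy : x = y
  · subst hxy
    exact ⟨Path.refl x, fun u v => by simp⟩
  set D := hypDist x y with hD
  have hD0 : 0 < D := lt_of_le_of_ne (hypDist_nonneg x y)
    fun h => hxy (eq_of_hypDist_eq_zero h.symm)
  have hS : 0 < Real.sinh D := Real.sinh_pos_iff.2 hD0
  -- Hyperbolic analogue of spherical linear interpolation, in the Lorentz plane spanned by the two
  -- endpoints.
  let p : ℝ → ℝ := fun u => Real.sinh (D * (1 - u)) / Real.sinh D
  let q : ℝ → ℝ := fun u => Real.sinh (D * u) / Real.sinh D
  let T : ℝ → ℝ := fun u => p u * hypTime x + q u * hypTime y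
  let V : ℝ → EuclideanSpace ℝ (Fin (n + 1)) := fun u => p u • hypSpace x + q u • hypSpace y
  have hxx : ‖hypSpace x‖ ^ 2 = hypTime x ^ 2 - 1 := by linarith [hypTime_sq x]
  have hyy : ‖hypSpace y‖ ^ 2 = hypTime y ^ 2 - 1 := by linarith [hypTime_sq y]
  have hxy' : inner ℝ (hypSpace x) (hypSpace y) = hypTime x * hypTime y - Real.cosh D := by
    linarith [cosh_hypDist_eq_hyperboloid x y]
  have hyx' : inner ℝ (hypSpace y) (hypSpace x) = hypTime x * hypTime y - Real.cosh D := by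
    rw [real_inner_comm]; exact hxy'
  have form : ∀ u v : ℝ, T u * T v - inner ℝ (V u) (V v) = Real.cosh (D * (u - v)) := by
    intro u v
    have h1 : T u * T v - inner ℝ (V u) (V v) =
        p u * p v + q u * q v + (p u * q v + q u * p v) * Real.cosh D := by
      simp only [T, V, inner_add_left, inner_add_right, real_inner_smul_left,
        real_inner_smul_right, real_inner_self_eq_norm_sq, hxx, hyy, hxy', hyx']
      ring
    rw [h1]
    simp only [p, q]
    have e : ∀ w, Real.sinh (D * (1 - w)) =
        Real.sinh D * Real.cosh (D * w) - Real.cosh D * Real.sinh (D * w) := fun w => by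
      rw [mul_sub, mul_one, Real.sinh_sub]
    rw [mul_sub D u v, Real.cosh_sub, e, e]
    have hc : Real.cosh D ^ 2 = Real.sinh D ^ 2 + 1 := Real.cosh_sq D
    field_simp
    linear_combination (-Real.sinh (D * u) * Real.sinh (D * v)) * hc
  have hT : ∀ u ∈ unitInterval, 0 < T u := by
    intro u hu
    have hp : 0 ≤ p u := div_nonneg (Real.sinh_nonneg_iff.2
      (mul_nonneg hD0.le (sub_nonneg.2 hu.2))) hS.le
    have hq : 0 ≤ q u := div_nonneg (Real.sinh_nonneg_iff.2 (mul_nonneg hD0.le hu.1)) hS.le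
    have h0 : 0 ≤ T u := add_nonneg (mul_nonneg hp (hypTime_pos x).le)
      (mul_nonneg hq (hypTime_pos y).le)
    have := form u u
    rw [sub_self, mul_zero, Real.cosh_zero, real_inner_self_eq_norm_sq] at this
    rcases h0.lt_or_eq with h | h
    · exact h
    · rw [← h] at this
      nlinarith [sq_nonneg ‖V u‖]
  have hTV : ∀ u, T u ^ 2 = 1 + ‖V u‖ ^ 2 := by
    intro u
    have := form u u
    rw [sub_self, mul_zero, Real.cosh_zero, real_inner_self_eq_norm_sq] at this
    linarith
  have hcont : Continuous T ∧ Continuous V := by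
    have hp : Continuous p := (Real.continuous_sinh.comp (by fun_prop)).div_const _
    have hq : Continuous q := (Real.continuous_sinh.comp (by fun_prop)).div_const _
    exact ⟨by fun_prop, by fun_prop⟩
  let σ : unitInterval → HypBall n := fun u => ofHyperboloid (T u) (V u) (hT u u.2) (hTV u)
  refine ⟨⟨⟨σ, ?_⟩, ?_, ?_⟩, ?_⟩
  · have h1 : Continuous fun u : unitInterval => (1 + T u)⁻¹ :=
      (continuous_const.add (hcont.1.comp continuous_subtype_val)).inv₀ fun u =>
        (add_pos one_pos (hT u u.2)).ne'
    exact Continuous.subtype_mk (h1.smul (hcont.2.comp continuous_subtype_val)) _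
  · conv_rhs => rw [← ofHyperboloid_coords x]
    simp [σ, T, V, p, q, div_self hS.ne']
  · conv_rhs => rw [← ofHyperboloid_coords y]
    simp [σ, T, V, p, q, div_self hS.ne']
  · intro u v
    refine hypDist_eq_of_cosh_eq (by positivity) ?_
    show Real.cosh (hypDist (σ u) (σ v)) = _
    rw [cosh_hypDist_eq_hyperboloid]
    simp only [σ, hypTime_ofHyperboloid, hypSpace_ofHyperboloid]
    rw [form, ← Real.cosh_abs, abs_mul, abs_of_pos hD0]

end HyperbolicMetric

/-! ### Proper discontinuity, freeness, and the covering onto the quotient. -/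

section KleinianAction

variable {n : ℕ} {G : Subgroup (Equiv.Perm (HypBall n))}

theorem exists_hypDist_lt_subset_of_mem_nhds {x : HypBall n} {U : Set (HypBall n)}
    (hU : U ∈ 𝓝 x) : ∃ ε > 0, ∀ y, hypDist x y < ε → y ∈ U := by
  obtain ⟨ε, hε, h⟩ := Metric.mem_nhds_iff.1 hU
  refine ⟨2 * Real.arsinh ε, by have := Real.arsinh_pos_iff.2 hε; positivity, fun y hy => h ?_⟩
  rw [Metric.mem_ball, dist_comm, Subtype.dist_eq, dist_eq_norm]
  refine (dist_le_sinh_half_hypDist x y).trans_lt ?_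
  rw [← Real.sinh_arsinh ε, Real.sinh_lt_sinh]
  linarith

theorem eventually_hypDist_lt (x : HypBall n) {ε : ℝ} (hε : 0 < ε) :
    ∀ᶠ y in 𝓝 x, hypDist x y < ε := by
  have h : Continuous fun y : HypBall n => hypDist x y := continuous_const.hypDist continuous_id
  exact h.continuousAt.eventually_lt continuousAt_const (by simpa using hε)

theorem IsKleinian.hypDist_smul (hG : IsKleinian G) (γ : G) (x y : HypBall n) :
    hypDist (γ • x) (γ • y) = hypDist x y :=
  hG.isometry γ γ.2 x y

theorem IsKleinian.hypDist_smul_left (hG : IsKleinian G) (γ : G) (x y : HypBall n) :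
    hypDist (γ • x) y = hypDist x (γ⁻¹ • y) := by
  rw [← hG.hypDist_smul γ x, smul_inv_smul]

/-- An element of a discrete group that displaces finitely many suitable points very little is
trivial. -/
theorem IsKleinian.exists_finset_displacement (hG : IsKleinian G) :
    ∃ (I : Finset (HypBall n)) (ε : HypBall n → ℝ), (∀ y, 0 < ε y) ∧
      ∀ γ : G, (∀ y ∈ I, hypDist y (γ • y) < ε y) → γ = 1 := by
  have := hG.discrete
  set D := (fun φ : Equiv.Perm (HypBall n) => (φ : HypBall n → HypBall n)) ''
      (G : Set (Equiv.Perm (HypBall n)))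
  have h1 : (id : HypBall n → HypBall n) ∈ D := ⟨1, G.one_mem, rfl⟩
  obtain ⟨U, hU, hUD⟩ := isOpen_induced_iff.1 (isOpen_discrete ({⟨id, h1⟩} : Set D))
  have hidU : (id : HypBall n → HypBall n) ∈ U := by
    have : (⟨id, h1⟩ : D) ∈ Subtype.val ⁻¹' U := by rw [hUD]; exact Set.mem_singleton _
    exact this
  obtain ⟨I, u, hu, hIU⟩ := isOpen_pi_iff.1 hU id hidU
  have hε : ∀ y : HypBall n, ∃ ε > 0, y ∈ I → ∀ w, hypDist y w < ε → w ∈ u y := by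
    intro y
    by_cases hy : y ∈ I
    · obtain ⟨ε, hε, h⟩ := exists_hypDist_lt_subset_of_mem_nhds ((hu y hy).1.mem_nhds (hu y hy).2)
      exact ⟨ε, hε, fun _ => h⟩
    · exact ⟨1, one_pos, fun h => absurd h hy⟩
  choose ε hε0 hε using hε
  refine ⟨I, ε, hε0, fun γ hγ => ?_⟩
  have hγD : ((γ : Equiv.Perm (HypBall n)) : HypBall n → HypBall n) ∈ D := ⟨γ, γ.2, rfl⟩
  have hmem : (⟨_, hγD⟩ : D) ∈ Subtype.val ⁻¹' U :=
    hIU fun y hy => hε y hy _ (hγ y hy)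
  rw [hUD, Set.mem_singleton_iff, Subtype.mk.injEq] at hmem
  exact Subtype.ext (Equiv.ext fun y => congrFun hmem y)

/-- Elements of bounded displacement at one point lie in a product of closed balls, compact by
Tychonoff. It is covered by finitely many neighbourhoods, each so small that two group elements in
it differ by an element displacing the points of `I` by less than `ε`, hence coincide. -/
theorem IsKleinian.finite_displacement_le (hG : IsKleinian G) (x : HypBall n) (R : ℝ) :
    {γ : G | hypDist x (γ • x) ≤ R}.Finite := by
  obtain ⟨I, ε, hε0, hI⟩ := hG.exists_finset_displacement
  let K : Set (HypBall n → HypBall n) :=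
    Set.univ.pi fun y => {w | hypDist y w ≤ R + 2 * hypDist x y}
  have hK : IsCompact K := isCompact_univ_pi fun y => isCompact_hypClosedBall y _
  let V : (HypBall n → HypBall n) → Set (HypBall n → HypBall n) :=
    fun f => {h | ∀ y ∈ I, hypDist (f y) (h y) < ε y / 2}
  have hV : ∀ f ∈ K, V f ∈ 𝓝 f := by
    intro f _
    refine (eventually_all_finset I).2 fun y _ => ?_
    exact (continuous_apply y).continuousAt.eventually
      (eventually_hypDist_lt (f y) (half_pos (hε0 y)))
  obtain ⟨t, -, ht⟩ := hK.elim_nhds_subcover V hV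
  refine (t.finite_toSet.biUnion fun f _ => Set.Subsingleton.finite
    (s := {γ : G | (fun y => γ • y) ∈ V f}) ?_).subset ?_
  · intro γ hγ γ' hγ'
    have : γ⁻¹ * γ' = 1 := hI _ fun y hy => by
      rw [mul_smul, hypDist_comm, hG.hypDist_smul_left, inv_inv]
      have h1 : hypDist (f y) (γ • y) < ε y / 2 := hγ y hy
      have h2 : hypDist (f y) (γ' • y) < ε y / 2 := hγ' y hy
      have h3 := hypDist_triangle (γ' • y) (f y) (γ • y)
      rw [hypDist_comm (γ' • y) (f y)] at h3
      linarith
    exact inv_mul_eq_one.1 this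
  · intro γ hγ
    have hγK : (fun y => γ • y) ∈ K := fun y _ => by
      have h1 : hypDist x (γ • x) ≤ R := hγ
      have h2 := hypDist_triangle y x (γ • y)
      have h3 := hypDist_triangle x (γ • x) (γ • y)
      rw [hG.hypDist_smul] at h3
      rw [hypDist_comm y x] at h2
      show hypDist y (γ • y) ≤ _
      linarith
    have := ht hγK
    simpa using this

theorem IsKleinian.eq_one_of_pow_displacement_le (hG : IsKleinian G)
    (htf : IsTorsionFreeSubgroup G) {γ : G} {x : HypBall n} {R : ℝ}
    (h : ∀ k : ℕ, hypDist x (γ ^ k • x) ≤ R) : γ = 1 := by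
  have hfin : IsOfFinOrder γ := by
    by_contra hnot
    have hinj := injective_pow_iff_not_isOfFinOrder.2 hnot
    exact Set.infinite_of_injective_forall_mem hinj h (hG.finite_displacement_le x R)
  exact Subtype.ext (htf γ γ.2 (Submonoid.isOfFinOrder_coe.2 hfin))

theorem IsKleinian.eq_one_of_smul_eq (hG : IsKleinian G) (htf : IsTorsionFreeSubgroup G) {γ : G}
    {x : HypBall n} (h : γ • x = x) : γ = 1 := by
  refine hG.eq_one_of_pow_displacement_le htf (x := x) (R := 0) fun k => ?_
  have : γ ^ k • x = x := by
    induction k with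
    | zero => simp
    | succ k ih => rw [pow_succ, mul_smul, h, ih]
  rw [this, hypDist_self]

theorem IsKleinian.smul_left_injective (hG : IsKleinian G) (htf : IsTorsionFreeSubgroup G)
    {γ γ' : G} {x : HypBall n} (h : γ • x = γ' • x) : γ = γ' := by
  have : (γ'⁻¹ * γ) • x = x := by rw [mul_smul, h, inv_smul_smul]
  exact (inv_mul_eq_one.1 (hG.eq_one_of_smul_eq htf this)).symm

theorem IsKleinian.exists_displacement_ge (hG : IsKleinian G) (htf : IsTorsionFreeSubgroup G)
    (x : HypBall n) : ∃ ε > 0, ∀ γ : G, γ ≠ 1 → ε ≤ hypDist x (γ • x) := by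
  have hfin := hG.finite_displacement_le x 1
  have hev : ∀ᶠ ε : ℝ in 𝓝[>] 0, ∀ γ ∈ {γ : G | hypDist x (γ • x) ≤ 1}, γ ≠ 1 →
      ε ≤ hypDist x (γ • x) := by
    refine (hfin.eventually_all).2 fun γ _ => ?_
    by_cases hγ : γ = 1
    · simp [hγ]
    have hpos : 0 < hypDist x (γ • x) := lt_of_le_of_ne (hypDist_nonneg _ _)
      fun h => hγ (hG.eq_one_of_smul_eq htf (eq_of_hypDist_eq_zero h.symm).symm)
    filter_upwards [Ioo_mem_nhdsGT hpos] with ε hε _ using hε.2.le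
  obtain ⟨ε, hε, hε0, hε1⟩ := (hev.and (Ioo_mem_nhdsGT one_pos)).exists
  refine ⟨ε, hε0, fun γ hγ => ?_⟩
  by_cases h : hypDist x (γ • x) ≤ 1
  · exact hε γ h hγ
  · linarith

theorem quotientProj_eq_iff {x y : HypBall n} :
    quotientProj G x = quotientProj G y ↔ ∃ γ : G, γ • y = x := by
  unfold quotientProj
  rw [Quotient.eq, MulAction.orbitRel_apply]
  exact Iff.rfl

@[simp] theorem quotientProj_smul (γ : G) (x : HypBall n) :
    quotientProj G (γ • x) = quotientProj G x :=
  quotientProj_eq_iff.2 ⟨γ, rfl⟩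

theorem IsKleinian.continuous_smul (hG : IsKleinian G) (γ : G) :
    Continuous fun x : HypBall n => γ • x := by
  refine continuous_iff_continuousAt.2 fun x U hU => ?_
  obtain ⟨ε, hε, h⟩ := exists_hypDist_lt_subset_of_mem_nhds hU
  exact (eventually_hypDist_lt x hε).mono fun y hy => h _ (by rwa [hG.hypDist_smul])

theorem IsKleinian.isQuotientCoveringMap (hG : IsKleinian G) (htf : IsTorsionFreeSubgroup G) :
    IsQuotientCoveringMap (quotientProj G) G where
  toIsQuotientMap := isQuotientMap_quotient_mk'
  continuous_const_smul := hG.continuous_smul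
  apply_eq_iff_mem_orbit := quotientProj_eq_iff
  disjoint x := by
    obtain ⟨ε, hε, h⟩ := hG.exists_displacement_ge htf x
    refine ⟨_, eventually_hypDist_lt x (half_pos hε), ?_⟩
    rintro γ ⟨_, ⟨y, hy, rfl⟩, hy'⟩
    by_contra hne
    have h1 : hypDist x y < ε / 2 := hy
    have h2 : hypDist x (γ • y) < ε / 2 := hy'
    have h3 := hypDist_triangle x (γ • y) (γ • x)
    rw [hG.hypDist_smul, hypDist_comm y x] at h3
    linarith [h γ hne]

theorem IsKleinian.isCoveringMap (hG : IsKleinian G) (htf : IsTorsionFreeSubgroup G) :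
    IsCoveringMap (quotientProj G) :=
  (hG.isQuotientCoveringMap htf).isCoveringMap

/-- The projection to the quotient is a local isometry. -/
theorem IsKleinian.eventually_quotientDist_eq (hG : IsKleinian G) (htf : IsTorsionFreeSubgroup G)
    (x : HypBall n) : ∃ U ∈ 𝓝 x, ∀ y ∈ U, ∀ y' ∈ U,
      quotientDist G (quotientProj G y) (quotientProj G y') = hypDist y y' := by
  obtain ⟨ε, hε, h⟩ := hG.exists_displacement_ge htf x
  -- With radius `ε / 4`, a nontrivial translate of `y'` is at least `ε / 2` from `y`, while `y` and
  -- `y'` are closer than `ε / 2`.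
  refine ⟨_, eventually_hypDist_lt x (show 0 < ε / 4 by linarith), fun y hy y' hy' => ?_⟩
  have h1 : hypDist x y < ε / 4 := hy
  have h2 : hypDist x y' < ε / 4 := hy'
  refine IsLeast.csInf_eq ⟨⟨y, y', rfl, rfl, rfl⟩, ?_⟩
  rintro d ⟨a, b, ha, hb, rfl⟩
  obtain ⟨γ, rfl⟩ := quotientProj_eq_iff.1 ha
  obtain ⟨γ', rfl⟩ := quotientProj_eq_iff.1 hb
  rw [hG.hypDist_smul_left, ← mul_smul]
  by_cases hγ : γ⁻¹ * γ' = 1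
  · rw [hγ, one_smul]
  have h3 := h _ hγ
  have h4 := hypDist_triangle x y ((γ⁻¹ * γ') • x)
  have h5 := hypDist_triangle y ((γ⁻¹ * γ') • y') ((γ⁻¹ * γ') • x)
  rw [hG.hypDist_smul, hypDist_comm y' x] at h5
  have h6 := hypDist_triangle y x y'
  rw [hypDist_comm y x] at h6
  linarith

end KleinianAction

/-! ### Holonomy, free homotopy, and lifting of geodesic segments. -/

section Loops

variable {n : ℕ} {G : Subgroup (Equiv.Perm (HypBall n))}

/-- The lift of the loop `c` that starts at `z` ends at `γ • z`. -/
def HasHolonomy {z : HypBall n} (c : Path (quotientProj G z) (quotientProj G z)) (γ : G) : Prop :=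
  ∃ σ : Path z (γ • z), ∀ s, quotientProj G (σ s) = c s

/-- The lifts share both endpoints, and the Euclidean straight-line homotopy between them stays in
the convex ball. -/
theorem HasHolonomy.freelyHomotopic {z : HypBall n}
    {c c' : Path (quotientProj G z) (quotientProj G z)} {γ : G} (h : HasHolonomy c γ)
    (h' : HasHolonomy c' γ) : FreelyHomotopic c c' := by
  obtain ⟨σ, hσ⟩ := h
  obtain ⟨σ', hσ'⟩ := h'
  have hmem : ∀ q : unitInterval × unitInterval,
      ‖(1 - (q.1 : ℝ)) • (σ q.2 : EuclideanSpace ℝ (Fin (n + 1))) + (q.1 : ℝ) •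
        (σ' q.2 : EuclideanSpace ℝ (Fin (n + 1)))‖ < 1 := by
    intro q
    have hconv := convex_ball (0 : EuclideanSpace ℝ (Fin (n + 1))) 1
    have := hconv (x := σ q.2) (by simpa using (σ q.2).2) (y := σ' q.2)
      (by simpa using (σ' q.2).2) (sub_nonneg.2 q.1.2.2) q.1.2.1 (by ring)
    simpa using this
  let F : unitInterval × unitInterval → HypBall n := fun q => ⟨_, hmem q⟩
  have hF : Continuous F := by
    refine Continuous.subtype_mk ?_ _
    have h1 : Continuous fun q : unitInterval × unitInterval => (q.1 : ℝ) := by fun_prop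
    have h2 : Continuous fun q : unitInterval × unitInterval =>
        (σ q.2 : EuclideanSpace ℝ (Fin (n + 1))) :=
      continuous_subtype_val.comp (σ.continuous.comp continuous_snd)
    have h3 : Continuous fun q : unitInterval × unitInterval =>
        (σ' q.2 : EuclideanSpace ℝ (Fin (n + 1))) :=
      continuous_subtype_val.comp (σ'.continuous.comp continuous_snd)
    exact ((continuous_const.sub h1).smul h2).add (h1.smul h3)
  refine ⟨⟨fun q => quotientProj G (F q), (continuous_quotientProj G).comp hF⟩, fun s => ?_,
    fun s => ?_, fun u => ?_⟩
  · have : F (0, s) = σ s := Subtype.ext (by simp [F])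
    simp [this, hσ]
  · have : F (1, s) = σ' s := Subtype.ext (by simp [F])
    simp [this, hσ']
  · have h0 : F (u, 0) = z := Subtype.ext (by simp [F, ← add_smul])
    have h1 : F (u, 1) = γ • z := Subtype.ext (by simp [F, ← add_smul])
    simp [h0, h1]

/-- In a lifted homotopy one lateral side is the `γ`-translate of the other, and the final edge is a
translate `a • σ'`, both by uniqueness of lifts. Matching them at the last corner gives `a γ' z = γ
a z`, and freeness of the action finishes. -/
theorem HasHolonomy.isConj (hG : IsKleinian G) (htf : IsTorsionFreeSubgroup G) {z : HypBall n}
    {c c' : Path (quotientProj G z) (quotientProj G z)} {γ γ' : G} (h : HasHolonomy c γ)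
    (h' : HasHolonomy c' γ') (hc : FreelyHomotopic c c') : IsConj γ γ' := by
  obtain ⟨σ, hσ⟩ := h
  obtain ⟨σ', hσ'⟩ := h'
  obtain ⟨H, H0, H1, Hend⟩ := hc
  have cov := hG.isCoveringMap htf
  have H0' : ∀ s, H (0, s) = quotientProj G ((σ : C(unitInterval, HypBall n)) s) :=
    fun s => (H0 s).trans (hσ s).symm
  let K := cov.liftHomotopy H σ H0'
  have hK : ∀ q, quotientProj G (K q) = H q := congrFun (cov.liftHomotopy_lifts H σ H0')
  have hK0 : ∀ s, K (0, s) = σ s := cov.liftHomotopy_zero H σ H0'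
  have side : ∀ u : unitInterval, K (u, 1) = γ • K (u, 0) := by
    refine congrFun (cov.eq_of_comp_eq (g₁ := fun u : unitInterval => K (u, 1))
      (g₂ := fun u => γ • K (u, 0)) (by fun_prop)
      ((hG.continuous_smul γ).comp (by fun_prop)) ?_ 0 ?_)
    · funext u
      simp [hK, Hend]
    · simp [hK0]
  obtain ⟨a, ha⟩ := quotientProj_eq_iff.1
    (show quotientProj G (K (1, 0)) = quotientProj G z by rw [hK, H1, c'.source])
  have top : ∀ s : unitInterval, K (1, s) = a • σ' s := by
    refine congrFun (cov.eq_of_comp_eq (g₁ := fun s : unitInterval => K (1, s))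
      (g₂ := fun s => a • σ' s) (by fun_prop)
      ((hG.continuous_smul a).comp σ'.continuous) ?_ 0 ?_)
    · funext s
      simp [hK, H1, hσ']
    · simp [ha]
  have h1 : (a * γ') • z = (γ * a) • z := by
    rw [mul_smul, mul_smul, ha, ← side 1, top 1, σ'.target]
  have h2 := hG.smul_left_injective htf h1
  refine IsConj.symm (isConj_iff.2 ⟨a, ?_⟩)
  rw [h2, mul_inv_cancel_right]

/-- A geodesic segment in the quotient lifts to a path no shorter than the distance between its
endpoints. -/
theorem IsGeodesicSegment.exists_lift (hG : IsKleinian G) (htf : IsTorsionFreeSubgroup G)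
    {z : HypBall n} {q : QuotientManifold G} {β : Path (quotientProj G z) q} {l : ℝ}
    (hβ : IsGeodesicSegment β l) : ∃ (w : HypBall n) (σ : Path z w),
      (∀ s, quotientProj G (σ s) = β s) ∧ hypDist z w ≤ l := by
  have cov := hG.isCoveringMap htf
  obtain ⟨Γ, hΓ, hΓ0⟩ := cov.exists_path_lifts β z β.source
  have hΓ' : ∀ s, quotientProj G (Γ s) = β s := congrFun hΓ
  refine ⟨Γ 1, ⟨Γ, hΓ0, rfl⟩, hΓ', ?_⟩
  have hloc : ∀ s : unitInterval, ∃ U : Set unitInterval, IsOpen U ∧ s ∈ U ∧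
      ∀ u ∈ U, ∀ v ∈ U, hypDist (Γ u) (Γ v) = l * |(u : ℝ) - v| := by
    intro s
    obtain ⟨U, hU, hUl⟩ := hβ.2 s
    obtain ⟨V, hV, hVl⟩ := hG.eventually_quotientDist_eq htf (Γ s)
    obtain ⟨W, hW, hWo, hsW⟩ := mem_nhds_iff.1
      (inter_mem hU (Γ.continuous.continuousAt.preimage_mem_nhds hV))
    refine ⟨W, hWo, hsW, fun u hu v hv => ?_⟩
    rw [← hVl _ (hW hu).2 _ (hW hv).2, hΓ', hΓ', hUl u (hW hu).1 v (hW hv).1]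
  choose U hUo hsU hU using hloc
  -- A finite subdivision on whose pieces the lift is exactly `l`-scaled; the triangle inequality
  -- adds up the pieces.
  obtain ⟨t, t0, tmono, ⟨m, hm⟩, ht⟩ := exists_monotone_Icc_subset_open_cover_unitInterval
    hUo (fun s _ => Set.mem_iUnion.2 ⟨s, hsU s⟩)
  have key : ∀ k, hypDist z (Γ (t k)) ≤ l * (t k : ℝ) := by
    intro k
    induction k with
    | zero => simp [t0, hΓ0]
    | succ k ih =>
      obtain ⟨s, hs⟩ := ht k
      have h1 := hU s (t k) (hs ⟨le_rfl, tmono k.le_succ⟩) (t (k + 1))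
        (hs ⟨tmono k.le_succ, le_rfl⟩)
      have h2 : (t k : ℝ) ≤ t (k + 1) := tmono k.le_succ
      rw [abs_sub_comm, abs_of_nonneg (sub_nonneg.2 h2)] at h1
      linarith [hypDist_triangle z (Γ (t k)) (Γ (t (k + 1)))]
  have := key m
  rw [hm m le_rfl] at this
  simpa using this

/-- A geodesic segment of the ball projects to a geodesic segment of the quotient. -/
theorem exists_isGeodesicSegment (hG : IsKleinian G) (htf : IsTorsionFreeSubgroup G)
    (z w : HypBall n) {q : QuotientManifold G} (hq : quotientProj G w = q) :
    ∃ (β : Path (quotientProj G z) q) (σ : Path z w),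
      (∀ s, quotientProj G (σ s) = β s) ∧ IsGeodesicSegment β (hypDist z w) := by
  subst hq
  obtain ⟨σ, hσ⟩ := exists_geodesic z w
  refine ⟨σ.map (continuous_quotientProj G), σ, fun s => rfl, hypDist_nonneg z w, fun s => ?_⟩
  obtain ⟨V, hV, hVl⟩ := hG.eventually_quotientDist_eq htf (σ s)
  refine ⟨σ ⁻¹' V, σ.continuous.continuousAt.preimage_mem_nhds hV, fun u hu v hv => ?_⟩
  rw [← hσ u v, ← hVl _ hu _ hv]
  rfl

/-- Running along the projection of an arc and back along the projection of a path from the same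
starting point gives a loop whose holonomy carries one end point to the other. -/
theorem hasHolonomy_projectedArc_trans (hG : IsKleinian G) {g : C(ℝ, HypBall n)} {T : ℝ}
    {w : HypBall n} {γ : G} (hw : γ • w = g T)
    {β : Path (quotientProj G (g 0)) (quotientProj G (g T))} {σ : Path (g 0) w}
    (hσ : ∀ s, quotientProj G (σ s) = β s) :
    HasHolonomy ((projectedArc G g T).trans β.symm) γ := by
  let a : Path (g 0) (g T) :=
    ⟨⟨fun s => g (T * (s : ℝ)), by fun_prop⟩, by simp, by simp⟩
  let b : Path (g T) (γ • g 0) := ((σ.map (hG.continuous_smul γ)).symm).cast hw.symm rfl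
  refine ⟨a.trans b, fun s => ?_⟩
  rw [Path.trans_apply, Path.trans_apply]
  split_ifs with h
  · rfl
  · show quotientProj G (γ • σ _) = β _
    rw [quotientProj_smul, hσ]

end Loops

/-! ### Busemann functions, horoballs and discreteness near the sphere. -/

section Horospheres

variable {n : ℕ} {G : Subgroup (Equiv.Perm (HypBall n))}

/-- The exponential of the Busemann function centred at `ξ`, normalised at the origin. -/
noncomputable def expBusemann (ξ : SphereAtInfinity n) (x : HypBall n) : ℝ :=
  ‖(x : EuclideanSpace ℝ (Fin (n + 1))) - ξ‖ ^ 2 /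
    (1 - ‖(x : EuclideanSpace ℝ (Fin (n + 1)))‖ ^ 2)

theorem norm_coe_sphereAtInfinity (ξ : SphereAtInfinity n) :
    ‖(ξ : EuclideanSpace ℝ (Fin (n + 1)))‖ = 1 :=
  mem_sphere_zero_iff_norm.1 ξ.2

theorem HypBall.coe_ne_sphere (x : HypBall n) (ξ : SphereAtInfinity n) :
    (x : EuclideanSpace ℝ (Fin (n + 1))) ≠ ξ := fun h => by
  have h1 := x.2
  rw [h, norm_coe_sphereAtInfinity] at h1
  exact lt_irrefl _ h1

theorem expBusemann_pos (ξ : SphereAtInfinity n) (x : HypBall n) : 0 < expBusemann ξ x :=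
  div_pos (pow_pos (norm_pos_iff.2 (sub_ne_zero.2 (x.coe_ne_sphere ξ))) 2) (one_sub_norm_sq_pos x)

/-- This is the Lorentz product of `x` with the null vector `(1, ξ)`, which is why it arises as a
limit of normalised `cosh` distances. -/
theorem expBusemann_eq (ξ : SphereAtInfinity n) (x : HypBall n) :
    expBusemann ξ x = hypTime x - inner ℝ (hypSpace x) (ξ : EuclideanSpace ℝ (Fin (n + 1))) := by
  have hx := one_sub_norm_sq_pos x
  unfold expBusemann hypTime hypSpace
  rw [norm_sub_sq_real, norm_coe_sphereAtInfinity, real_inner_smul_left]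
  field_simp
  ring

theorem mem_horoball_iff (ξ : SphereAtInfinity n) {r : ℝ} (hr0 : 0 < r) (hr1 : r < 1)
    (x : HypBall n) : x ∈ horoball ξ r ↔ expBusemann ξ x < r / (1 - r) := by
  have hx := one_sub_norm_sq_pos x
  have hr : 0 < 1 - r := by linarith
  unfold expBusemann
  rw [div_lt_div_iff₀ hx hr]
  show ‖(x : EuclideanSpace ℝ (Fin (n + 1))) -
    (1 - r) • (ξ : EuclideanSpace ℝ (Fin (n + 1)))‖ < r ↔ _
  rw [← sq_lt_sq₀ (norm_nonneg _) hr0.le, norm_sub_sq_real, norm_sub_sq_real, norm_smul,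
    norm_coe_sphereAtInfinity, real_inner_smul_right, Real.norm_eq_abs, abs_of_pos hr]
  constructor <;> intro h <;> linarith

theorem tendsto_cosh_hypDist_div_hypTime {ι : Type*} {l : Filter ι} {ξ : SphereAtInfinity n}
    {w : ι → HypBall n} (hw : Tendsto (fun i => (w i : EuclideanSpace ℝ (Fin (n + 1)))) l (𝓝 ξ))
    (x : HypBall n) :
    Tendsto (fun i => Real.cosh (hypDist x (w i)) / hypTime (w i)) l (𝓝 (expBusemann ξ x)) := by
  have heq : (fun i => Real.cosh (hypDist x (w i)) / hypTime (w i)) = fun i => hypTime x -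
      2 / (1 + ‖(w i : EuclideanSpace ℝ (Fin (n + 1)))‖ ^ 2) *
        inner ℝ (hypSpace x) (w i : EuclideanSpace ℝ (Fin (n + 1))) := by
    funext i
    have h1 := one_sub_norm_sq_pos (w i)
    rw [cosh_hypDist_eq_hyperboloid, sub_div, mul_div_cancel_right₀ _ (hypTime_pos (w i)).ne']
    congr 1
    rw [hypSpace.eq_1 (w i), real_inner_smul_right]
    unfold hypTime
    field_simp
  rw [heq, expBusemann_eq]
  have hnorm : Tendsto (fun i => 1 + ‖(w i : EuclideanSpace ℝ (Fin (n + 1)))‖ ^ 2) l (𝓝 2) := by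
    have := (hw.norm.pow 2).const_add 1
    rwa [norm_coe_sphereAtInfinity, one_pow, one_add_one_eq_two] at this
  have h2 := (tendsto_const_nhds (x := (2 : ℝ))).div hnorm two_ne_zero
  have h3 := (h2.mul ((tendsto_const_nhds (x := hypSpace x)).inner (𝕜 := ℝ) hw)).const_sub
    (hypTime x)
  simpa using h3

theorem tendsto_cosh_hypDist_div {ι : Type*} {l : Filter ι} {ξ : SphereAtInfinity n}
    {w : ι → HypBall n} (hw : Tendsto (fun i => (w i : EuclideanSpace ℝ (Fin (n + 1)))) l (𝓝 ξ))
    (x y : HypBall n) :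
    Tendsto (fun i => Real.cosh (hypDist x (w i)) / Real.cosh (hypDist y (w i))) l
      (𝓝 (expBusemann ξ x / expBusemann ξ y)) := by
  refine ((tendsto_cosh_hypDist_div_hypTime hw x).div (tendsto_cosh_hypDist_div_hypTime hw y)
    (expBusemann_pos ξ y).ne').congr fun i => ?_
  simp only [Pi.div_apply]
  rw [div_div_div_cancel_right₀ (hypTime_pos (w i)).ne']

theorem exists_seq_tendsto_sphere (ξ : SphereAtInfinity n) : ∃ w : ℕ → HypBall n,
    Tendsto (fun k => (w k : EuclideanSpace ℝ (Fin (n + 1)))) atTop (𝓝 ξ) := by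
  refine ⟨fun k => ⟨((k : ℝ) / (k + 1)) • (ξ : EuclideanSpace ℝ (Fin (n + 1))), ?_⟩, ?_⟩
  · rw [norm_smul, norm_coe_sphereAtInfinity, mul_one, Real.norm_eq_abs,
      abs_of_nonneg (by positivity), div_lt_one (by positivity)]
    linarith
  · simpa using (tendsto_natCast_div_add_atTop (1 : ℝ)).smul_const
      (ξ : EuclideanSpace ℝ (Fin (n + 1)))

theorem cosh_add_le_exp_mul_cosh {a : ℝ} (ha : 0 ≤ a) (b : ℝ) :
    Real.cosh (a + b) ≤ Real.exp a * Real.cosh b := by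
  rw [Real.cosh_eq, Real.cosh_eq, neg_add, Real.exp_add, Real.exp_add]
  have h1 : Real.exp (-a) ≤ Real.exp a := Real.exp_le_exp.2 (by linarith)
  have h2 := mul_le_mul_of_nonneg_right h1 (Real.exp_pos (-b)).le
  linarith

/-- The triangle inequality in the limit of a third point tending to `ξ`: Busemann functions are
1-Lipschitz. It allows the base point of an orbit to be changed. -/
theorem expBusemann_le_exp_hypDist_mul (ξ : SphereAtInfinity n) (x y : HypBall n) :
    expBusemann ξ x ≤ Real.exp (hypDist x y) * expBusemann ξ y := by
  obtain ⟨w, hw⟩ := exists_seq_tendsto_sphere ξ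
  rw [← div_le_iff₀ (expBusemann_pos ξ y)]
  refine le_of_tendsto (tendsto_cosh_hypDist_div hw x y) (Eventually.of_forall fun i => ?_)
  rw [div_le_iff₀ (Real.cosh_pos _)]
  refine le_trans ?_ (cosh_add_le_exp_mul_cosh (hypDist_nonneg x y) _)
  exact (hypDist_le_iff_cosh_le (add_nonneg (hypDist_nonneg _ _) (hypDist_nonneg _ _))).1
    (hypDist_triangle x y (w i))

/-- Since `d(x, g s) - s` does not increase with `s`, a bound at a single time persists to infinity.
-/
theorem IsGeodesicToward.expBusemann_le {ξ : SphereAtInfinity n} {z : HypBall n}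
    {g : C(ℝ, HypBall n)} (hg : IsGeodesicToward ξ z g) {x : HypBall n} {t M : ℝ}
    (h : hypDist x (g t) ≤ t + M) : expBusemann ξ x ≤ Real.exp |M| * expBusemann ξ z := by
  rw [← div_le_iff₀ (expBusemann_pos ξ z)]
  refine le_of_tendsto (tendsto_cosh_hypDist_div hg.endpoint x z) ?_
  filter_upwards [eventually_ge_atTop t, eventually_ge_atTop 0] with s hts hs
  rw [div_le_iff₀ (Real.cosh_pos _)]
  have h1 : hypDist z (g s) = s := by
    rw [← hg.start, hg.unit_speed, zero_sub, abs_neg, abs_of_nonneg hs]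
  have h2 := hypDist_triangle x (g t) (g s)
  rw [hg.unit_speed, abs_sub_comm, abs_of_nonneg (sub_nonneg.2 hts)] at h2
  rw [h1]
  refine le_trans ?_ (cosh_add_le_exp_mul_cosh (abs_nonneg M) s)
  exact (hypDist_le_iff_cosh_le (by positivity)).1 (by linarith [le_abs_self M])

/-- Here `M` depends only on the level `C`; only the time from which the bound holds depends on `x`.
-/
theorem IsGeodesicToward.exists_eventually_hypDist_le {ξ : SphereAtInfinity n} {z : HypBall n}
    {g : C(ℝ, HypBall n)} (hg : IsGeodesicToward ξ z g) (C : ℝ) :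
    ∃ M : ℝ, ∀ x, expBusemann ξ x ≤ C → ∀ᶠ t in atTop, hypDist x (g t) ≤ t + M := by
  have hz := expBusemann_pos ξ z
  set K := |C| / expBusemann ξ z + 1 with hK
  have hK1 : 1 ≤ K := le_add_of_nonneg_left (by positivity)
  -- The factor 2 compensates `cosh t ≤ exp t` against `cosh (t + M) ≥ exp (t + M) / 2`.
  refine ⟨Real.log (2 * K), fun x hx => ?_⟩
  have hM : 0 ≤ Real.log (2 * K) := Real.log_nonneg (by linarith)
  have hlt : expBusemann ξ x / expBusemann ξ z < K := by
    rw [hK]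
    refine lt_of_le_of_lt ?_ (lt_add_one _)
    gcongr
    exact hx.trans (le_abs_self C)
  filter_upwards [(tendsto_cosh_hypDist_div hg.endpoint x z).eventually_lt_const hlt,
    eventually_ge_atTop 0] with t ht ht0
  have h1 : hypDist z (g t) = t := by
    rw [← hg.start, hg.unit_speed, zero_sub, abs_neg, abs_of_nonneg ht0]
  rw [div_lt_iff₀ (Real.cosh_pos _), h1] at ht
  rw [hypDist_le_iff_cosh_le (by positivity)]
  refine ht.le.trans ?_
  rw [Real.cosh_eq, Real.cosh_eq, Real.exp_add, Real.exp_log (by linarith)]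
  have h2 : Real.exp (-t) ≤ Real.exp t := Real.exp_le_exp.2 (by linarith)
  have h3 := Real.exp_pos (-(t + Real.log (2 * K)))
  nlinarith

theorem IsKleinian.finite_one_sub_norm_sq_ge (hG : IsKleinian G) (x : HypBall n) {δ : ℝ}
    (hδ : 0 < δ) :
    {γ : G | δ ≤ 1 - ‖((γ • x : HypBall n) : EuclideanSpace ℝ (Fin (n + 1)))‖ ^ 2}.Finite := by
  have hx := one_sub_norm_sq_pos x
  set K := 1 + 2 * 2 ^ 2 / ((1 - ‖(x : EuclideanSpace ℝ (Fin (n + 1)))‖ ^ 2) * δ) with hK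
  have hK1 : 1 ≤ K := le_add_of_nonneg_right (by positivity)
  refine (hG.finite_displacement_le x (Real.arcosh K)).subset fun γ hγ => ?_
  have hγ' : δ ≤ 1 - ‖((γ • x : HypBall n) : EuclideanSpace ℝ (Fin (n + 1)))‖ ^ 2 := hγ
  show hypDist x (γ • x) ≤ Real.arcosh K
  rw [hypDist_le_iff_cosh_le (Real.arcosh_nonneg hK1), Real.cosh_arcosh hK1, cosh_hypDist, hK]
  gcongr
  exact (norm_sub_le _ _).trans (by linarith [x.2, (γ • x).2])

/-- A horoball meets the sphere only at `ξ`: away from `ξ`, a bound on the Busemann exponential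
keeps points off the sphere, where discreteness leaves finitely many. -/
theorem IsKleinian.finite_expBusemann_le_of_dist_ge (hG : IsKleinian G) (ξ : SphereAtInfinity n)
    (x : HypBall n) (C : ℝ) {ε : ℝ} (hε : 0 < ε) :
    {γ : G | expBusemann ξ (γ • x) ≤ C ∧
      ε ≤ ‖((γ • x : HypBall n) : EuclideanSpace ℝ (Fin (n + 1))) - ξ‖}.Finite := by
  have hC : 0 < |C| + 1 := by positivity
  refine (hG.finite_one_sub_norm_sq_ge x (show 0 < ε ^ 2 / (|C| + 1) by positivity)).subset ?_
  rintro γ ⟨h1, h2⟩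
  have hx := one_sub_norm_sq_pos (γ • x)
  unfold expBusemann at h1
  rw [div_le_iff₀ hx] at h1
  refine (div_le_iff₀ hC).2 ?_
  have h3 : ε ^ 2 ≤ ‖((γ • x : HypBall n) : EuclideanSpace ℝ (Fin (n + 1))) - ξ‖ ^ 2 := by gcongr
  nlinarith [le_abs_self C]

theorem IsKleinian.mem_bigHorosphericLimitSet (hG : IsKleinian G) (htf : IsTorsionFreeSubgroup G)
    {ξ : SphereAtInfinity n} {z : HypBall n} {C : ℝ}
    (h : {γ : G | expBusemann ξ (γ • z) ≤ C}.Infinite) : ξ ∈ bigHorosphericLimitSet G := by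
  have hall : ∀ x : HypBall n,
      {γ : G | expBusemann ξ (γ • x) ≤ Real.exp (hypDist x z) * C}.Infinite := by
    intro x
    refine h.mono fun γ hγ => ?_
    have h1 := expBusemann_le_exp_hypDist_mul ξ (γ • x) (γ • z)
    rw [hG.hypDist_smul] at h1
    exact h1.trans (mul_le_mul_of_nonneg_left hγ (Real.exp_pos _).le)
  refine ⟨fun x => ?_, fun x => ?_⟩
  · rw [accPt_iff_nhds]
    intro U hU
    obtain ⟨ε, hε, hεU⟩ := Metric.mem_nhds_iff.1 hU
    obtain ⟨γ, hγ, hγ'⟩ := ((hall x).sdiff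
      (hG.finite_expBusemann_le_of_dist_ge ξ x _ hε)).nonempty
    refine ⟨(γ • x : HypBall n), ⟨hεU ?_, ⟨γ • x, ⟨γ, rfl⟩, rfl⟩⟩, (γ • x).coe_ne_sphere ξ⟩
    rw [Metric.mem_ball, dist_eq_norm]
    by_contra hge
    exact hγ' ⟨hγ, not_lt.1 hge⟩
  -- The radius `K / (K + 1)` solves `r / (1 - r) = K`; the added 1 makes the inequality strict, as
  -- the horoball is open.
  · set K := |Real.exp (hypDist x z) * C| + 1 with hK
    have hK0 : 0 < K := by positivity
    have hr1 : K / (K + 1) < 1 := (div_lt_one (by positivity)).2 (by linarith)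
    refine ⟨K / (K + 1), by positivity, hr1, ?_⟩
    have hinj : Set.InjOn (fun γ : G => γ • x)
        {γ : G | expBusemann ξ (γ • x) ≤ Real.exp (hypDist x z) * C} :=
      fun γ _ γ' _ h => hG.smul_left_injective htf h
    refine ((hall x).image hinj).mono ?_
    rintro _ ⟨γ, hγ, rfl⟩
    refine ⟨⟨γ, rfl⟩, (mem_horoball_iff ξ (by positivity) hr1 _).2 ?_⟩
    have h1 : K / (K + 1) / (1 - K / (K + 1)) = K := by field_simp; ring
    have h2 : expBusemann ξ (γ • x) ≤ Real.exp (hypDist x z) * C := hγ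
    simp only [h1]
    linarith [le_abs_self (Real.exp (hypDist x z) * C)]

theorem exists_infinite_expBusemann_le {ξ : SphereAtInfinity n}
    (h : ξ ∈ bigHorosphericLimitSet G) (z : HypBall n) :
    ∃ C : ℝ, {γ : G | expBusemann ξ (γ • z) ≤ C}.Infinite := by
  obtain ⟨r, hr0, hr1, hinf⟩ := h.2 z
  refine ⟨r / (1 - r), Set.Infinite.of_image (fun γ : G => γ • z) (hinf.mono ?_)⟩
  rintro _ ⟨⟨γ, rfl⟩, hγ⟩
  exact ⟨γ, ((mem_horoball_iff ξ hr0 hr1 _).1 hγ).le, rfl⟩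

end Horospheres

/-! ### Orbits of Euclidean isometries. -/

section StationarySequences

variable {E : Type*} [NormedAddCommGroup E] [InnerProductSpace ℝ E]

theorem inner_sub_sub_eq_dist (a b c d : E) : inner ℝ (a - b) (c - d) =
    (dist a d ^ 2 + dist b c ^ 2 - dist a c ^ 2 - dist b d ^ 2) / 2 := by
  simp only [dist_eq_norm, norm_sub_sq_real, inner_sub_left, inner_sub_right]
  ring

/-- A sequence of vectors with shift-invariant inner products is an orbit of a linear isometry. -/
theorem exists_linearIsometry_of_inner_succ [FiniteDimensional ℝ E] (u : ℕ → E)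
    (hu : ∀ i j, inner ℝ (u (i + 1)) (u (j + 1)) = inner ℝ (u i) (u j)) :
    ∃ A : E →ₗᵢ[ℝ] E, ∀ i, A (u i) = u (i + 1) := by
  let L := Finsupp.linearCombination ℝ u
  let L' := Finsupp.linearCombination ℝ fun i => u (i + 1)
  have hnorm : ∀ c, ‖L' c‖ = ‖L c‖ := by
    intro c
    rw [← sq_eq_sq₀ (norm_nonneg _) (norm_nonneg _), ← real_inner_self_eq_norm_sq,
      ← real_inner_self_eq_norm_sq]
    simp only [L, L', Finsupp.linearCombination_apply, Finsupp.sum_inner, Finsupp.inner_sum,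
      real_inner_smul_left, real_inner_smul_right, hu]
  -- Equality of norms makes `L' ∘ f` isometric on the span and independent of the section `f` of
  -- `L`.
  obtain ⟨f, hf⟩ := L.rangeRestrict.exists_rightInverse_of_surjective L.range_rangeRestrict
  have hf' : ∀ v, L (f v) = v := fun v => congrArg Subtype.val (LinearMap.congr_fun hf v)
  let A₀ : LinearMap.range L →ₗᵢ[ℝ] E := ⟨L' ∘ₗ f, fun v => by
    rw [LinearMap.comp_apply, hnorm, hf', Submodule.coe_norm]⟩
  refine ⟨A₀.extend, fun i => ?_⟩
  have hui : u i = L (Finsupp.single i 1) := by simp [L]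
  have hui' : u (i + 1) = L' (Finsupp.single i 1) := by simp [L']
  have hmem : u i ∈ LinearMap.range L := ⟨_, hui.symm⟩
  have h1 := A₀.extend_apply ⟨u i, hmem⟩
  rw [show A₀.extend (u i) = _ from h1, hui']
  show L' (f ⟨u i, hmem⟩) = _
  rw [← sub_eq_zero, ← map_sub, ← norm_eq_zero, hnorm, map_sub, hf', ← hui, sub_self, norm_zero]

/-- Along an orbit of a Euclidean isometry the distance from the starting point grows linearly up to
a bounded error. -/
theorem exists_abs_dist_sub_le_of_dist_succ [FiniteDimensional ℝ E] (y : ℕ → E)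
    (hy : ∀ i j, dist (y (i + 1)) (y (j + 1)) = dist (y i) (y j)) :
    ∃ τ K : ℝ, ∀ k : ℕ, |dist (y k) (y 0) - k * τ| ≤ K := by
  obtain ⟨A, hA⟩ := exists_linearIsometry_of_inner_succ (fun i => y (i + 1) - y i) fun i j => by
    rw [inner_sub_sub_eq_dist, inner_sub_sub_eq_dist, hy, hy, hy, hy]
  -- The first step splits as `(A w - w) + p` with `p` orthogonal to the range of `A - 1`, hence
  -- fixed by `A`. Summing the steps telescopes to `A^k w - w + k p`, so `τ = ‖p‖` with error at
  -- most `2 ‖w‖`.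
  obtain ⟨v, ⟨w, hw⟩, p, hp, hvp⟩ :=
    (LinearMap.range (A.toLinearMap - LinearMap.id)).exists_add_mem_mem_orthogonal (y 1 - y 0)
  have hw' : v = A w - w := hw.symm
  have hAp : A p = p := by
    have h1 : inner ℝ (A p - p) p = 0 := (Submodule.mem_orthogonal _ _).1 hp _ ⟨p, rfl⟩
    rw [← sub_eq_zero, ← norm_eq_zero, ← sq_eq_zero_iff, norm_sub_sq_real, A.norm_map]
    rw [inner_sub_left, real_inner_self_eq_norm_sq] at h1
    linarith
  have hu : ∀ k, y (k + 1) - y k = A^[k + 1] w - A^[k] w + p := by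
    intro k
    induction k with
    | zero => simpa [hw'] using hvp
    | succ k ih =>
      rw [← hA k, ih, map_add, map_sub, hAp, ← Function.iterate_succ_apply' A,
        ← Function.iterate_succ_apply' A]
  have hsum : ∀ k : ℕ, y k - y 0 = (A^[k] w - w) + (k : ℝ) • p := by
    intro k
    induction k with
    | zero => simp
    | succ k ih =>
      rw [← sub_add_sub_cancel (y (k + 1)) (y k) (y 0), hu, ih, Nat.cast_succ, add_smul, one_smul]
      abel
  have hit : ∀ k, ‖A^[k] w‖ = ‖w‖ := by
    intro k
    induction k with
    | zero => rfl
    | succ k ih => rw [Function.iterate_succ_apply', A.norm_map, ih]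
  refine ⟨‖p‖, 2 * ‖w‖, fun k => ?_⟩
  have h1 : (k : ℝ) * ‖p‖ = ‖(k : ℝ) • p‖ := by rw [norm_smul, RCLike.norm_natCast]
  rw [dist_eq_norm, h1]
  refine (abs_norm_sub_norm_le _ _).trans ?_
  rw [hsum, add_sub_cancel_right]
  refine (norm_sub_le _ _).trans ?_
  rw [hit]
  linarith

end StationarySequences

/-! ### Finiteness within a conjugacy class, by Ptolemy's inequality. -/

section ConjugacyClasses

theorem exists_seq_pairwise_not_isConj {Γ : Type*} [Group Γ] {S : Set Γ} (hS : S.Infinite)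
    (h : ∀ a, {γ ∈ S | IsConj a γ}.Finite) :
    ∃ u : ℕ → Γ, (∀ k, u k ∈ S) ∧ Pairwise fun j k => ¬ IsConj (u j) (u k) := by
  have hinf : (ConjClasses.mk '' S).Infinite := by
    intro hfin
    refine hS (Set.Finite.of_finite_fibers ConjClasses.mk hfin fun c _ => ?_)
    obtain ⟨a, rfl⟩ := ConjClasses.exists_rep c
    refine (h a).subset fun γ hγ => ⟨hγ.1, ?_⟩
    exact (ConjClasses.mk_eq_mk_iff_isConj.1 hγ.2).symm
  let e := hinf.natEmbedding
  have he : ∀ k, ∃ γ ∈ S, ConjClasses.mk γ = (e k).1 := fun k => (e k).2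
  choose u hu hue using he
  refine ⟨u, hu, fun j k hjk hconj => hjk (e.injective (Subtype.ext ?_))⟩
  rw [← hue, ← hue]
  exact ConjClasses.mk_eq_mk_iff_isConj.2 hconj

variable {n : ℕ} {G : Subgroup (Equiv.Perm (HypBall n))}

/-- Ptolemy's inequality in hyperbolic space. -/
theorem sinh_half_hypDist_ptolemy (a b c d : HypBall n) :
    Real.sinh (hypDist a c / 2) * Real.sinh (hypDist b d / 2) ≤
      Real.sinh (hypDist a b / 2) * Real.sinh (hypDist c d / 2) +
        Real.sinh (hypDist b c / 2) * Real.sinh (hypDist a d / 2) := by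
  have h := EuclideanGeometry.mul_dist_le_mul_dist_add_mul_dist
    (a : EuclideanSpace ℝ (Fin (n + 1))) b c d
  simp only [dist_eq_norm] at h
  simp only [sinh_half_hypDist]
  have ha := Real.sqrt_pos.2 (one_sub_norm_sq_pos a)
  have hb := Real.sqrt_pos.2 (one_sub_norm_sq_pos b)
  have hc := Real.sqrt_pos.2 (one_sub_norm_sq_pos c)
  have hd := Real.sqrt_pos.2 (one_sub_norm_sq_pos d)
  generalize √(1 - ‖(a : EuclideanSpace ℝ (Fin (n + 1)))‖ ^ 2) = A at *
  generalize √(1 - ‖(b : EuclideanSpace ℝ (Fin (n + 1)))‖ ^ 2) = B at *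
  generalize √(1 - ‖(c : EuclideanSpace ℝ (Fin (n + 1)))‖ ^ 2) = C at *
  generalize √(1 - ‖(d : EuclideanSpace ℝ (Fin (n + 1)))‖ ^ 2) = D at *
  rw [div_mul_div_comm, div_mul_div_comm, div_mul_div_comm,
    show A * C * (B * D) = A * B * C * D by ring, show A * B * (C * D) = A * B * C * D by ring,
    show B * C * (A * D) = A * B * C * D by ring, ← add_div]
  gcongr

/-- For `a ≥ 1` the decaying exponential in `sinh (a / 2)` is at most half of the growing one. -/
theorem sinh_half_add_le {a l : ℝ} (ha : 1 ≤ a) :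
    Real.sinh ((a + l) / 2) ≤ 2 * Real.exp (l / 2) * Real.sinh (a / 2) := by
  have h1 : 2 ≤ Real.exp a := by linarith [Real.add_one_le_exp a]
  have h2 : Real.exp a = Real.exp (a / 2) * Real.exp (a / 2) := by rw [← Real.exp_add]; ring_nf
  have h3 : Real.exp (-(a / 2)) * Real.exp (a / 2) = 1 := by rw [← Real.exp_add]; simp
  have h4 : 2 * Real.exp (-(a / 2)) ≤ Real.exp (a / 2) := by
    refine le_of_mul_le_mul_right ?_ (Real.exp_pos (a / 2))
    rw [mul_assoc, h3, ← h2]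
    linarith
  have h5 := Real.exp_pos (l / 2)
  have h6 := Real.exp_pos (-((a + l) / 2))
  rw [Real.sinh_eq, Real.sinh_eq, show (a + l) / 2 = l / 2 + a / 2 by ring, Real.exp_add]
  rw [show (a + l) / 2 = l / 2 + a / 2 by ring] at h6
  nlinarith [mul_le_mul_of_nonneg_left h4 h5.le]

/-- If the forward and backward images of `z` stay apart on the sphere at infinity, a conjugacy class
contains only elements of bounded displacement. -/
theorem IsKleinian.finite_isConj_of_dist_ge (hG : IsKleinian G) (z : HypBall n) {c : ℝ}
    (hc : 0 < c) (a : G) :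
    {γ : G | c ≤ ‖((γ • z : HypBall n) : EuclideanSpace ℝ (Fin (n + 1))) - (γ⁻¹ • z : HypBall n)‖ ∧
      IsConj a γ}.Finite := by
  set l := hypDist z (a • z) with hl
  have hz := one_sub_norm_sq_pos z
  -- The conformal factor of `z` enters squared and both chords from `z` are at most 2, whence the
  -- 4; this gives `sinh (d(γz, γ⁻¹z) / 2) ≥ c' D²`, with `D` defined below.
  set c' := c * (1 - ‖(z : EuclideanSpace ℝ (Fin (n + 1)))‖ ^ 2) / 4 with hc'
  have hc'0 : 0 < c' := by positivity
  set R := max (2 + l) (2 * Real.arsinh (4 * Real.exp (l / 2) / c')) with hR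
  refine (hG.finite_displacement_le z R).subset ?_
  rintro γ ⟨hγc, hconj⟩
  obtain ⟨b, hb⟩ := isConj_iff.1 hconj
  show hypDist z (γ • z) ≤ R
  set x := b • z with hx
  have hdisp : hypDist x (γ • x) = l := by
    rw [← hb, hx, ← mul_smul, inv_mul_cancel_right, mul_smul, hG.hypDist_smul]
  set d := hypDist z x with hd
  have h1 : hypDist (γ • z) x ≤ d + l := by
    have := hypDist_triangle (γ • z) (γ • x) x
    rwa [hG.hypDist_smul, hypDist_comm (γ • x), hdisp] at this
  have h2 : hypDist (γ⁻¹ • z) x ≤ d + l := by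
    rw [hG.hypDist_smul_left, inv_inv]
    exact (hypDist_triangle z x (γ • x)).trans (by rw [hdisp])
  -- The point `x` has displacement `l` under `γ`. If it is near `z`, then `z` has displacement at
  -- most `2 + l`; otherwise Ptolemy compares a left side quadratic in `D` with a right side linear
  -- in `D`, both carrying the factor `sinh (d / 2)`.
  rcases le_total d 1 with hd1 | hd1
  · have := hypDist_triangle z x (γ • z)
    rw [hypDist_comm x] at this
    exact le_max_of_le_left (by linarith)
  refine le_max_of_le_right ?_
  set D := Real.sinh (hypDist z (γ • z) / 2) with hD
  have hD' : Real.sinh (hypDist (γ⁻¹ • z) z / 2) = D := by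
    rw [hG.hypDist_smul_left, inv_inv]
  have hD'' : Real.sinh (hypDist (γ • z) z / 2) = D := by rw [hypDist_comm]
  have hD0 : 0 ≤ D := Real.sinh_nonneg_iff.2 (by have := hypDist_nonneg z (γ • z); positivity)
  have hsd : 0 < Real.sinh (d / 2) := Real.sinh_pos_iff.2 (by linarith)
  have hpt := sinh_half_hypDist_ptolemy (γ • z) z (γ⁻¹ • z) x
  rw [hD'', hypDist_comm z (γ⁻¹ • z), hD', ← hd] at hpt
  have hlow : c' * D ^ 2 ≤ Real.sinh (hypDist (γ • z) (γ⁻¹ • z) / 2) := by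
    have e : D ^ 2 = Real.sinh (hypDist (γ • z) z / 2) * Real.sinh (hypDist (γ⁻¹ • z) z / 2) := by
      rw [hD', hD'', sq]
    rw [e, sinh_half_hypDist, sinh_half_hypDist, sinh_half_hypDist, div_mul_div_comm, hc']
    have hA := Real.sqrt_pos.2 (one_sub_norm_sq_pos (γ • z))
    have hB := Real.sqrt_pos.2 (one_sub_norm_sq_pos (γ⁻¹ • z))
    have hz2 := Real.mul_self_sqrt hz.le
    have hz3 := Real.sqrt_pos.2 hz
    have n1 : ‖((γ • z : HypBall n) : EuclideanSpace ℝ (Fin (n + 1))) - z‖ ≤ 2 :=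
      (norm_sub_le _ _).trans (by linarith [z.2, (γ • z).2])
    have n2 : ‖((γ⁻¹ • z : HypBall n) : EuclideanSpace ℝ (Fin (n + 1))) - z‖ ≤ 2 :=
      (norm_sub_le _ _).trans (by linarith [z.2, (γ⁻¹ • z).2])
    have n3 := mul_le_mul n1 n2 (norm_nonneg _) zero_le_two
    generalize √(1 - ‖((γ • z : HypBall n) : EuclideanSpace ℝ (Fin (n + 1)))‖ ^ 2) = A at *
    generalize √(1 - ‖((γ⁻¹ • z : HypBall n) : EuclideanSpace ℝ (Fin (n + 1)))‖ ^ 2) = B at *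
    generalize √(1 - ‖(z : EuclideanSpace ℝ (Fin (n + 1)))‖ ^ 2) = Z at *
    generalize ‖((γ • z : HypBall n) : EuclideanSpace ℝ (Fin (n + 1))) - z‖ *
      ‖((γ⁻¹ • z : HypBall n) : EuclideanSpace ℝ (Fin (n + 1))) - z‖ = N at *
    rw [← hz2]
    calc c * (Z * Z) / 4 * (N / (A * Z * (B * Z))) = c * (N / 4) / (A * B) := by field_simp
      _ ≤ c * 1 / (A * B) := by gcongr; linarith
      _ ≤ ‖((γ • z : HypBall n) : EuclideanSpace ℝ (Fin (n + 1))) - (γ⁻¹ • z : HypBall n)‖ /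
          (A * B) := by rw [mul_one]; gcongr
  have hup : ∀ w, hypDist w x ≤ d + l →
      Real.sinh (hypDist w x / 2) ≤ 2 * Real.exp (l / 2) * Real.sinh (d / 2) := fun w hw =>
    (Real.sinh_le_sinh.2 (by linarith)).trans (sinh_half_add_le hd1)
  have hfin : D * (c' * D) ≤ D * (4 * Real.exp (l / 2)) := by
    refine le_of_mul_le_mul_right ?_ hsd
    calc D * (c' * D) * Real.sinh (d / 2) = c' * D ^ 2 * Real.sinh (d / 2) := by ring
      _ ≤ Real.sinh (hypDist (γ • z) (γ⁻¹ • z) / 2) * Real.sinh (d / 2) := by gcongr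
      _ ≤ _ := hpt
      _ ≤ D * (2 * Real.exp (l / 2) * Real.sinh (d / 2)) +
          D * (2 * Real.exp (l / 2) * Real.sinh (d / 2)) := by
        gcongr
        · exact hup _ h2
        · exact hup _ h1
      _ = D * (4 * Real.exp (l / 2)) * Real.sinh (d / 2) := by ring
  have hDle : D ≤ 4 * Real.exp (l / 2) / c' := by
    rcases hD0.eq_or_lt with h | h
    · rw [← h]; positivity
    · rw [le_div_iff₀ hc'0, mul_comm]
      exact le_of_mul_le_mul_left hfin h
  have := Real.arsinh_le_arsinh.2 hDle
  rw [hD, Real.arsinh_sinh] at this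
  linarith

end ConjugacyClasses

/-! ### Pairwise nonconjugate elements with orbit points in a horoball. -/

section NonconjugateSequences

variable {n : ℕ} {G : Subgroup (Equiv.Perm (HypBall n))}

/-- Inversion at `ξ` carries the ball to a half-space. On a single horosphere hyperbolic distance is
thus a function of Euclidean distance. -/
theorem sinh_half_hypDist_eq_dist_inversion (ξ : SphereAtInfinity n) (x y : HypBall n) :
    Real.sinh (hypDist x y / 2) =
      dist (EuclideanGeometry.inversion (ξ : EuclideanSpace ℝ (Fin (n + 1))) 1 x)
        (EuclideanGeometry.inversion (ξ : EuclideanSpace ℝ (Fin (n + 1))) 1 y) *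
      (√(expBusemann ξ x) * √(expBusemann ξ y)) := by
  have hx := one_sub_norm_sq_pos x
  have hy := one_sub_norm_sq_pos y
  have hxξ : 0 < ‖(x : EuclideanSpace ℝ (Fin (n + 1))) - ξ‖ :=
    norm_pos_iff.2 (sub_ne_zero.2 (x.coe_ne_sphere ξ))
  have hyξ : 0 < ‖(y : EuclideanSpace ℝ (Fin (n + 1))) - ξ‖ :=
    norm_pos_iff.2 (sub_ne_zero.2 (y.coe_ne_sphere ξ))
  rw [sinh_half_hypDist, EuclideanGeometry.dist_inversion_inversion (x.coe_ne_sphere ξ)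
    (y.coe_ne_sphere ξ)]
  unfold expBusemann
  rw [Real.sqrt_div' _ hx.le, Real.sqrt_div' _ hy.le, Real.sqrt_sq hxξ.le, Real.sqrt_sq hyξ.le,
    dist_eq_norm, dist_eq_norm, dist_eq_norm]
  field_simp

/-- If the orbit points `γ⁻¹ • z`, and all their translates, converge to `ξ` then every element of
the group multiplies the exponential Busemann function at `ξ` by a constant. -/
theorem IsKleinian.expBusemann_smul_mul (hG : IsKleinian G) {ξ : SphereAtInfinity n} {ι : Type*}
    {l : Filter ι} [l.NeBot] {w : ι → HypBall n}
    (hw : ∀ δ : G, Tendsto (fun i => ((δ • w i : HypBall n) : EuclideanSpace ℝ (Fin (n + 1)))) l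
      (𝓝 ξ)) (δ : G) (x y : HypBall n) :
    expBusemann ξ (δ • x) * expBusemann ξ y = expBusemann ξ (δ • y) * expBusemann ξ x := by
  have h1 := tendsto_cosh_hypDist_div (by simpa using hw 1) (δ • x) (δ • y)
  have h2 := tendsto_cosh_hypDist_div (hw δ⁻¹) x y
  simp only [hG.hypDist_smul_left] at h1
  have h3 := tendsto_nhds_unique h1 h2
  rwa [div_eq_div_iff (expBusemann_pos _ _).ne' (expBusemann_pos _ _).ne',
    mul_comm (expBusemann ξ x)] at h3

/-- A contracting character on the group produces pairwise nonconjugate powers inside a horoball. -/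
theorem exists_seq_of_expBusemann_character {ξ : SphereAtInfinity n} {χ : G → ℝ}
    (hχ : ∀ (δ : G) (x : HypBall n), expBusemann ξ (δ • x) = χ δ * expBusemann ξ x) {h : G}
    (h1 : χ h < 1) (z : HypBall n) :
    ∃ u : ℕ → G, (∀ k, expBusemann ξ (u k • z) ≤ expBusemann ξ z) ∧
      Pairwise fun j k => ¬ IsConj (u j) (u k) := by
  have hpos : ∀ δ, 0 < χ δ := fun δ => by
    have h2 := expBusemann_pos ξ (δ • z)
    rw [hχ] at h2
    exact pos_of_mul_pos_left h2 (expBusemann_pos ξ z).le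
  have hmul : ∀ δ δ', χ (δ * δ') = χ δ * χ δ' := fun δ δ' => by
    refine mul_right_cancel₀ (expBusemann_pos ξ z).ne' ?_
    rw [← hχ, mul_smul, hχ, hχ, mul_assoc]
  have hone : χ 1 = 1 := by
    refine mul_right_cancel₀ (expBusemann_pos ξ z).ne' ?_
    rw [← hχ, one_smul, one_mul]
  let X : G →* ℝ := ⟨⟨χ, hone⟩, hmul⟩
  have hpow : ∀ k : ℕ, χ (h ^ k) = χ h ^ k := map_pow X h
  refine ⟨fun k => h ^ k, fun k => ?_, fun j k hjk hconj => hjk ?_⟩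
  · rw [hχ, hpow]
    exact mul_le_of_le_one_left (expBusemann_pos ξ z).le (pow_le_one₀ (hpos h).le h1.le)
  · have h2 := isConj_iff_eq.1 (X.map_isConj hconj)
    have h3 : χ h ^ j = χ h ^ k := by rw [← hpow, ← hpow]; exact h2
    exact pow_right_injective₀ (hpos h) h1.ne h3

/-- In a group that preserves the horospheres at `ξ`, the powers of a nontrivial element are pairwise
nonconjugate. -/
theorem IsKleinian.not_isConj_pow_of_expBusemann_smul (hG : IsKleinian G)
    (htf : IsTorsionFreeSubgroup G) {ξ : SphereAtInfinity n}
    (hB : ∀ (δ : G) (x : HypBall n), expBusemann ξ (δ • x) = expBusemann ξ x) {h : G}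
    (h1 : h ≠ 1) (z : HypBall n) : Pairwise fun j k : ℕ => ¬ IsConj (h ^ j) (h ^ k) := by
  let J : HypBall n → EuclideanSpace ℝ (Fin (n + 1)) := fun x =>
    EuclideanGeometry.inversion (ξ : EuclideanSpace ℝ (Fin (n + 1))) 1 x
  have hs : ∀ x y, Real.sinh (hypDist x y / 2) =
      dist (J x) (J y) * (√(expBusemann ξ x) * √(expBusemann ξ y)) :=
    sinh_half_hypDist_eq_dist_inversion ξ
  have hJ : ∀ (δ : G) (x y : HypBall n), dist (J (δ • x)) (J (δ • y)) = dist (J x) (J y) := by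
    intro δ x y
    have hx := Real.sqrt_pos.2 (expBusemann_pos ξ x)
    have hy := Real.sqrt_pos.2 (expBusemann_pos ξ y)
    refine mul_right_cancel₀ (mul_pos hx hy).ne' ?_
    rw [← hs, ← hG.hypDist_smul δ x y, hs, hB, hB]
  obtain ⟨τ, K, hτ⟩ := exists_abs_dist_sub_le_of_dist_succ (fun k : ℕ => J (h ^ k • z))
    fun i j => by rw [pow_succ', pow_succ', mul_smul, mul_smul, hJ]
  simp only [pow_zero, one_smul] at hτ
  -- With zero translation length all powers of `h` would displace `z` boundedly, forcing `h = 1`.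
  have hτ0 : 0 < τ := by
    by_contra hneg
    refine h1 (hG.eq_one_of_pow_displacement_le htf (x := z)
      (R := 2 * Real.arsinh (K * (√(expBusemann ξ z) * √(expBusemann ξ z)))) fun k => ?_)
    have h2 : dist (J z) (J (h ^ k • z)) ≤ K := by
      have h3 := (abs_le.1 (hτ k)).2
      have h4 : (k : ℝ) * τ ≤ 0 := mul_nonpos_of_nonneg_of_nonpos k.cast_nonneg (not_lt.1 hneg)
      rw [dist_comm]
      linarith
    have h5 : Real.sinh (hypDist z (h ^ k • z) / 2) ≤
        K * (√(expBusemann ξ z) * √(expBusemann ξ z)) := by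
      rw [hs, hB]
      gcongr
    have h6 := Real.arsinh_le_arsinh.2 h5
    rw [Real.arsinh_sinh] at h6
    linarith
  have key : ∀ i j : ℕ, IsConj (h ^ i) (h ^ j) → j ≤ i := by
    intro i j hij
    obtain ⟨a, ha⟩ := isConj_iff.1 hij
    by_contra hlt
    have hlt' : (i : ℝ) + 1 ≤ j := by exact_mod_cast not_le.1 hlt
    set c := dist (J (a • z)) (J z) with hc
    -- Conjugation by `a` costs at most `2 c`, so taking `m`-th powers gives `j m τ - K ≤ i m τ + K
    -- + 2 c`, which fails for large `m` when `j > i`.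
    have hm : ∀ m : ℕ, (m : ℝ) * τ ≤ 2 * K + 2 * c := by
      intro m
      have e : h ^ (j * m) • z = a • h ^ (i * m) • a⁻¹ • z := by
        rw [pow_mul, ← ha, conj_pow, ← pow_mul, mul_smul, mul_smul]
      have d1 := dist_triangle4 (J (a • h ^ (i * m) • a⁻¹ • z)) (J (a • h ^ (i * m) • z))
        (J (a • z)) (J z)
      have d2 : dist (J (a⁻¹ • z)) (J z) = c := by
        rw [← hJ a, smul_inv_smul, dist_comm]
      rw [hJ, hJ, d2, hJ, ← e] at d1
      have d3 := (abs_le.1 (hτ (j * m))).1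
      have d4 := (abs_le.1 (hτ (i * m))).2
      push_cast at d3 d4
      have d5 := mul_le_mul_of_nonneg_right hlt' (mul_nonneg m.cast_nonneg hτ0.le : 0 ≤ (m : ℝ) * τ)
      linarith
    obtain ⟨m, hm'⟩ := exists_nat_gt ((2 * K + 2 * c) / τ)
    rw [div_lt_iff₀ hτ0] at hm'
    linarith [hm m]
  exact fun j k hjk hconj => hjk (le_antisymm (key _ _ hconj.symm) (key _ _ hconj))

/-- If a horoball contains infinitely many orbit points, then some horoball contains orbit points
coming from pairwise nonconjugate group elements. -/
theorem IsKleinian.exists_seq_not_isConj (hG : IsKleinian G) (htf : IsTorsionFreeSubgroup G)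
    {ξ : SphereAtInfinity n} {z : HypBall n} {C : ℝ}
    (hS : {γ : G | expBusemann ξ (γ • z) ≤ C}.Infinite) :
    ∃ (C' : ℝ) (u : ℕ → G), (∀ k, expBusemann ξ (u k • z) ≤ C') ∧
      Pairwise fun j k => ¬ IsConj (u j) (u k) := by
  set S := {γ : G | expBusemann ξ (γ • z) ≤ C} with hSdef
  -- Either some translate of the inverse orbit stays off `ξ` infinitely often, or all of them
  -- converge to `ξ`. The translation by `δ` makes the second alternative strong enough to control
  -- every group element.
  by_cases hcase : ∃ (δ : G) (ε : ℝ), 0 < ε ∧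
    {γ ∈ S | ε ≤ ‖((δ • γ⁻¹ • z : HypBall n) : EuclideanSpace ℝ (Fin (n + 1))) - ξ‖}.Infinite
  · obtain ⟨δ, ε, hε, hinf⟩ := hcase
    set C' := Real.exp (hypDist (δ⁻¹ • z) z) * C with hC'
    have hle : ∀ γ ∈ S, expBusemann ξ (γ • δ⁻¹ • z) ≤ C' := fun γ hγ => by
      have h1 := expBusemann_le_exp_hypDist_mul ξ (γ • δ⁻¹ • z) (γ • z)
      rw [hG.hypDist_smul] at h1
      exact h1.trans (mul_le_mul_of_nonneg_left hγ (Real.exp_pos _).le)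
    -- Dropping finitely many elements puts `γ δ⁻¹ z` within `ε / 2` of `ξ`, hence at least `ε / 2`
    -- from `δ γ⁻¹ z`, its image under the inverse element.
    have hT := (hinf.sdiff (hG.finite_expBusemann_le_of_dist_ge ξ (δ⁻¹ • z) C' (half_pos hε))).image
      (f := fun γ => γ * δ⁻¹) (mul_left_injective δ⁻¹).injOn
    obtain ⟨u, hu, hconj⟩ := exists_seq_pairwise_not_isConj hT fun a =>
      (hG.finite_isConj_of_dist_ge z (half_pos hε) a).subset (by
        rintro _ ⟨⟨γ, ⟨⟨hγS, hγ⟩, hγ'⟩, rfl⟩, hconj⟩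
        refine ⟨?_, hconj⟩
        have h1 : ‖((γ • δ⁻¹ • z : HypBall n) : EuclideanSpace ℝ (Fin (n + 1))) - ξ‖ < ε / 2 := by
          by_contra hge
          exact hγ' ⟨hle γ hγS, not_lt.1 hge⟩
        rw [mul_inv_rev, inv_inv, mul_smul, mul_smul]
        have h2 := norm_sub_le_norm_sub_add_norm_sub
          ((δ • γ⁻¹ • z : HypBall n) : EuclideanSpace ℝ (Fin (n + 1))) (γ • δ⁻¹ • z : HypBall n) ξ
        rw [norm_sub_rev ((δ • γ⁻¹ • z : HypBall n) : EuclideanSpace ℝ (Fin (n + 1)))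
          (γ • δ⁻¹ • z : HypBall n)] at h2
        linarith)
    refine ⟨C', u, fun k => ?_, hconj⟩
    obtain ⟨γ, ⟨⟨hγS, -⟩, -⟩, hγ⟩ := hu k
    rw [← hγ]
    simpa only [mul_smul] using hle γ hγS
  · have hfin : ∀ (δ : G) (ε : ℝ), 0 < ε → {γ ∈ S | ε ≤ ‖((δ • γ⁻¹ • z : HypBall n) :
        EuclideanSpace ℝ (Fin (n + 1))) - ξ‖}.Finite := fun δ ε hε => by
      by_contra h
      exact hcase ⟨δ, ε, hε, h⟩
    have := hS.to_subtype
    have hw : ∀ δ : G, Tendsto (fun γ : S => ((δ • (γ : G)⁻¹ • z : HypBall n) :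
        EuclideanSpace ℝ (Fin (n + 1)))) cofinite (𝓝 ξ) := by
      intro δ
      rw [Metric.tendsto_nhds]
      intro ε hε
      have h1 := (hfin δ ε hε).preimage (f := ((↑) : S → G)) Subtype.val_injective.injOn
      refine h1.subset fun γ hγ => ⟨γ.2, ?_⟩
      have h2 : ¬ dist ((δ • (γ : G)⁻¹ • z : HypBall n) : EuclideanSpace ℝ (Fin (n + 1))) ξ < ε := hγ
      rwa [dist_eq_norm, not_lt] at h2
    have hχ : ∀ (δ : G) (x : HypBall n),
        expBusemann ξ (δ • x) = expBusemann ξ (δ • z) / expBusemann ξ z * expBusemann ξ x := by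
      intro δ x
      rw [div_mul_eq_mul_div, eq_div_iff (expBusemann_pos ξ z).ne']
      exact hG.expBusemann_smul_mul hw δ x z
    by_cases hpar : ∀ δ : G, expBusemann ξ (δ • z) / expBusemann ξ z = 1
    · obtain ⟨h, -, h1⟩ := hS.exists_notMem_finite (Set.finite_singleton (1 : G))
      have hB : ∀ (δ : G) (x : HypBall n), expBusemann ξ (δ • x) = expBusemann ξ x :=
        fun δ x => by rw [hχ, hpar, one_mul]
      exact ⟨expBusemann ξ z, fun k => h ^ k, fun k => (hB _ z).le,
        hG.not_isConj_pow_of_expBusemann_smul htf hB h1 z⟩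
    · push Not at hpar
      obtain ⟨δ, hδ⟩ := hpar
      obtain ⟨h, hh⟩ : ∃ h : G, expBusemann ξ (h • z) / expBusemann ξ z < 1 := by
        rcases lt_or_gt_of_ne hδ with h | h
        · exact ⟨δ, h⟩
        · refine ⟨δ⁻¹, ?_⟩
          have h2 := hχ δ (δ⁻¹ • z)
          rw [smul_inv_smul] at h2
          rw [div_lt_one (expBusemann_pos ξ z)]
          conv_rhs => rw [h2]
          exact lt_mul_of_one_lt_left (expBusemann_pos ξ _) h
      obtain ⟨u, hu⟩ := exists_seq_of_expBusemann_character hχ hh z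
      exact ⟨_, u, hu⟩

end NonconjugateSequences

/-! ### The equivalence for loops in the quotient. -/

theorem mainTheorem5 (n : ℕ) (hn : 1 ≤ n) (G : Subgroup (Equiv.Perm (HypBall n)))
    (hG : IsKleinian G) (htf : IsTorsionFreeSubgroup G) (z : HypBall n) (ξ : SphereAtInfinity n)
    (g : C(ℝ, HypBall n)) (hg : IsGeodesicToward ξ z g) :
    ξ ∈ bigHorosphericLimitSet G ↔
      ∃ t : ℕ → ℝ, t 0 = 0 ∧ StrictMono t ∧ Tendsto t atTop atTop ∧
        ∃ M : ℝ, ∃ β : ∀ k : ℕ, Path (quotientProj G (g 0)) (quotientProj G (g (t k))),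
          (∀ k, ∃ l : ℝ, l ≤ t k + M ∧ IsGeodesicSegment (β k) l) ∧
          Pairwise fun j k : ℕ =>
            ¬ FreelyHomotopic ((projectedArc G g (t j)).trans (β j).symm)
              ((projectedArc G g (t k)).trans (β k).symm) := by
  constructor
  · intro hξ
    obtain ⟨C, hC⟩ := exists_infinite_expBusemann_le hξ (g 0)
    obtain ⟨C', u, hu, hconj⟩ := hG.exists_seq_not_isConj htf hC
    obtain ⟨M, hM⟩ := hg.exists_eventually_hypDist_le C'
    have hT : ∀ k, ∃ T : ℝ, ∀ t ≥ T, hypDist (u k • g 0) (g t) ≤ t + M := fun k =>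
      eventually_atTop.1 (hM _ (hu k))
    choose T hT using hT
    -- Partial sums make `t` strictly increasing, at least `k`, and past the threshold `T k` for `k
    -- ≥ 1`. Since `t 0 = 0` is prescribed, the first bound is absorbed into the constant by the
    -- `max` below.
    let t : ℕ → ℝ := fun k => ∑ i ∈ Finset.range k, (1 + |T (i + 1)|)
    have ht0 : t 0 = 0 := Finset.sum_range_zero _
    have hts : ∀ k, t (k + 1) = t k + (1 + |T (k + 1)|) := fun k => Finset.sum_range_succ _ _
    have hmono : StrictMono t := strictMono_nat_of_lt_succ fun k => by
      rw [hts]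
      linarith [abs_nonneg (T (k + 1))]
    have hge : ∀ k : ℕ, (k : ℝ) ≤ t k := by
      intro k
      induction k with
      | zero => simp [ht0]
      | succ k ih =>
        rw [hts]
        push_cast
        linarith [abs_nonneg (T (k + 1))]
    have hbound : ∀ k, hypDist (g 0) ((u k)⁻¹ • g (t k)) ≤
        t k + max M (hypDist (u 0 • g 0) (g 0)) := by
      intro k
      rw [← hG.hypDist_smul_left]
      cases k with
      | zero => rw [ht0, zero_add]; exact le_max_right _ _
      | succ k =>
        refine (hT (k + 1) _ ?_).trans (add_le_add_right (le_max_left _ _) _)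
        rw [hts]
        have h1 : (0 : ℝ) ≤ t k := k.cast_nonneg.trans (hge k)
        linarith [le_abs_self (T (k + 1))]
    -- Ending the lift of `β_k` at `(u k)⁻¹ • g (t k)` gives the loop holonomy `u k`.
    have hβ := fun k => exists_isGeodesicSegment hG htf (g 0) ((u k)⁻¹ • g (t k))
      (quotientProj_smul (u k)⁻¹ (g (t k)))
    choose β σ hσ hβ using hβ
    refine ⟨t, ht0, hmono, tendsto_atTop_mono hge tendsto_natCast_atTop_atTop, _, β,
      fun k => ⟨_, hbound k, hβ k⟩, fun j k hjk hfree => hconj hjk ?_⟩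
    exact HasHolonomy.isConj hG htf
      (hasHolonomy_projectedArc_trans hG (smul_inv_smul _ _) (hσ j))
      (hasHolonomy_projectedArc_trans hG (smul_inv_smul _ _) (hσ k)) hfree
  · rintro ⟨t, -, -, -, M, β, hβ, hfree⟩
    have hlift : ∀ k, ∃ γ : G, expBusemann ξ (γ • g 0) ≤ Real.exp |M| * expBusemann ξ z ∧
        HasHolonomy ((projectedArc G g (t k)).trans (β k).symm) γ := by
      intro k
      obtain ⟨l, hl, hgeo⟩ := hβ k
      obtain ⟨w, σ, hσ, hle⟩ := hgeo.exists_lift hG htf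
      have hw : quotientProj G (g (t k)) = quotientProj G w := by
        rw [← (β k).target, ← hσ, σ.target]
      obtain ⟨γ, hγ⟩ := quotientProj_eq_iff.1 hw
      refine ⟨γ, hg.expBusemann_le (t := t k) ?_, hasHolonomy_projectedArc_trans hG hγ hσ⟩
      rw [← hγ, hG.hypDist_smul]
      exact hle.trans hl
    choose γ hγ hhol using hlift
    refine hG.mem_bigHorosphericLimitSet htf (z := g 0) (C := Real.exp |M| * expBusemann ξ z) ?_
    -- Distinct indices have distinct holonomies, since a common holonomy would make the two loops
    -- freely homotopic.
    refine Set.infinite_of_injective_forall_mem (f := γ) (fun j k hjk => ?_) hγ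
    by_contra hne
    have h1 := hhol k
    rw [← hjk] at h1
    exact hfree hne ((hhol j).freelyHomotopic h1)
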